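/- **Setting.** There are $K$ sellers and a buyer who wants to estimate $\theta\in\mathbb R$. Seller $i$'s data are i.i.d. $N(\theta,\sigma_i^2)$, where $\sigma_i=\sigma_L$ with probability $\mu$ and $\sigma_i=\sigma_H$ with probability $1-\mu$ ($0<\sigma_L<\sigma_H$, $0<\mu<1$). The per-sample cost $c_i$ has density $f$, with distribution function $F$, supported on $[c_{\min},c_{\max}]$, $0<c_{\min}<c_{\max}$. All these draws are independent across sellers and costs are independent of qualities. Let $\lambda>0$, $M\ge 2$, and let $\psi(c)=c+F(c)/f(c)$ be the virtual cost. *Free samples.* First each seller $i$ commits to a number $m_i\in\{0,2,3,\dots,M\}$ of free samples. Then costs and qualities are realized and the free samples are drawn. By Bayes' rule from the sample variance of seller $i$'s free samples (no update if $m_i=0$), the buyer forms the belief $\pi_i$ about $\sigma_i^2$, with mean $\bar\sigma_i^2=\pi_i(\sigma_L^2)\sigma_L^2+\pi_i(\sigma_H^2)\sigma_H^2$. *Procurement.* At beliefs $\pi$ the buyer runs a direct, possibly randomized, mechanism that maps the reported costs to purchases $n_i\in\mathbb Z_{\ge 0}$, payments $t_i\in\mathbb R$ and weights $w_i\ge 0$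 with $\sum_i w_i=1$. Seller $i$'s utility is $t_i-n_ic_i$. The buyer's expected cost is $\mathbb E\big[\sum_i w_i^2\bar\sigma_i^2/n_i+\lambda\sum_i t_i\big]$ at truthful reports (the $i$-th term of the first sum is $0$ if $w_i=0$ and $+\infty$ if $w_i>0=n_i$). A mechanism is a $\zeta$-approximate solution at $\pi$ if it is Bayesian incentive compatible and interim individually rational, and its expected buyer cost is at most $1+\zeta$ times that of every other such mechanism. *The single-sourcing mechanism.* The buyer buys only from one seller $i^*\in\arg\min_i\bar\sigma_i^2\psi(c_i)$, ties being broken uniformly at random, and buys $\big\lfloor\bar\sigma_{i^*}/\sqrt{\lambda\psi(c_{i^*})}\big\rfloor$ samples from $i^*$, who gets all the weight. The payments are $t_i(c)=c_in_i(c)+\int_{c_i}^{c_{\max}}n_i(z,c_{-i})\,dz$. *Equilibrium.* Given the mechanism that the buyer uses at each belief profile, let $\bar U_i(m)$ be seller $i$'s expected utility over costs, free samples and tie-breaking, at truthful reports, when the sellers commit to $m=(m_1,\dots,m_K)$. The profile $m$ is a *seller equilibrium* if $\bar U_i(m_i',m_{-i})\le\bar U_i(m)$ for all $i$ and all $m_i'\in\{0,2,3,\dots,M\}$.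 The profile $m$ and the mechanism form a *$\zeta$-approximate subgame perfect equilibrium* if the mechanism is a $\zeta$-approximate solution at every belief profile and $m$ is a seller equilibrium. **Theorem.** Suppose that $\psi$ is non-decreasing on $[c_{\min},c_{\max}]$, that $\ell\le f(c)\le L$ for all $c\in[c_{\min},c_{\max}]$ with constants $0<\ell\le L$, and that $\sigma_L\ge\alpha\sqrt{\lambda\psi(c_{\max})}$ for some $\alpha\ge 3$. Then there is a threshold $\bar K$, depending on these parameters ($\sigma_L,\sigma_H,\mu,\lambda,M,f,\alpha$) but not on $\theta$, such that for every number of sellers $K\ge\bar K$: 1. the profile $m=(M,\dots,M)$ together with the single-sourcing mechanism is a $1/(\alpha-1)$-approximate subgame perfect equilibrium; 2. given that the buyer uses the single-sourcing mechanism, $(M,\dots,M)$ is the only seller equilibrium. -/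

import Mathlib

open MeasureTheory ProbabilityTheory
open scoped ENNReal NNReal

noncomputable section

/-- The primitives of the data market, common to all sellers: the support `[cmin, cmax]` and the
density `f` of the per-sample cost, the two possible standard deviations `sigL < sigH` of a
seller's data, the prior probability `mu` of `sigL`, the buyer's weight `lam` on payments and
the maximal number `M` of free samples. -/
structure Market where
  cmin : ℝ
  cmax : ℝ
  f : ℝ → ℝ
  sigL : ℝ
  sigH : ℝ
  mu : ℝ
  lam : ℝ
  M : ℕ
  cmin_pos : 0 < cmin
  cmin_lt_cmax : cmin < cmax
  f_measurable : Measurable f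
  f_nonneg : ∀ c, 0 ≤ f c
  f_support : ∀ c, c ∉ Set.Icc cmin cmax → f c = 0
  f_lintegral : ∫⁻ c, ENNReal.ofReal (f c) = 1
  sigL_pos : 0 < sigL
  sigL_lt_sigH : sigL < sigH
  mu_pos : 0 < mu
  mu_lt_one : mu < 1
  lam_pos : 0 < lam
  two_le_M : 2 ≤ M

/-- A direct, possibly randomized, procurement mechanism for `K` sellers. It maps a profile of
reported costs and a random seed in `S` to the number of samples purchased from each seller, the
payment to each seller, and the weights of the estimator. -/
structure Mechanism (K : ℕ) (S : Type) where
  purchase : (Fin K → ℝ) → S → Fin K → ℕ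
  pay : (Fin K → ℝ) → S → Fin K → ℝ
  weight : (Fin K → ℝ) → S → Fin K → ℝ≥0

/-- A ranking of the sellers, used to break ties. -/
abbrev Ranking (K : ℕ) : Type := Equiv.Perm (Fin K)

instance instMeasurableSpaceRanking (K : ℕ) : MeasurableSpace (Ranking K) := ⊤

/-- The uniform distribution on rankings. -/
def rankingLaw (K : ℕ) : Measure (Ranking K) :=
  (PMF.uniformOfFintype (Ranking K)).toMeasure

/-- The sample variance `S² = (m - 1)⁻¹ ∑ⱼ (xⱼ - x̄)²` of `m` samples (used for `m ≥ 2`). -/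
def sampleVar {m : ℕ} (x : Fin m → ℝ) : ℝ :=
  (∑ j, (x j - (∑ k, x k) / (m : ℝ)) ^ 2) / ((m : ℝ) - 1)

namespace Market

variable (E : Market)

/-! ### Costs -/

/-- The distribution of a seller's per-sample cost. -/
def costLaw : Measure ℝ := volume.withDensity fun c => ENNReal.ofReal (E.f c)

/-- The virtual cost `ψ(c) = c + F(c) / f(c)`. -/
def virtualCost (c : ℝ) : ℝ := c + cdf E.costLaw c / E.f c

/-- The joint law of the i.i.d. costs of the `K` sellers and the independent seed of a
mechanism. -/
def costSeedLaw (K : ℕ) {S : Type} [MeasurableSpace S] (ρ : Measure S) :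
    Measure ((Fin K → ℝ) × S) :=
  (Measure.pi fun _ : Fin K => E.costLaw).prod ρ

/-! ### The procurement stage, for fixed beliefs

A belief about a seller is the probability `p` of the high variance `sigH ^ 2`. -/

/-- The mean of the belief distribution over variances. -/
def meanVar (p : ℝ) : ℝ := (1 - p) * E.sigL ^ 2 + p * E.sigH ^ 2

/-- The variance `∑ wᵢ² σ̄ᵢ² / nᵢ` of the weighted estimator under the buyer's beliefs. It is
infinite if positive weight is put on a seller from whom nothing is purchased; sellers of zero
weight do not contribute. -/
def estimatorVar {K : ℕ} (p : Fin K → ℝ) (n : Fin K → ℕ) (w : Fin K → ℝ≥0) : ℝ≥0∞ :=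
  ∑ i, (w i : ℝ≥0∞) ^ 2 * ENNReal.ofReal (E.meanVar (p i)) / (n i : ℝ≥0∞)

/-- Seller `i`'s utility with true cost `ci` when the reported costs are `c` and the seed is
`s`. -/
def _root_.Mechanism.sellerUtility {K : ℕ} {S : Type} (A : Mechanism K S) (i : Fin K) (ci : ℝ)
    (c : Fin K → ℝ) (s : S) : ℝ :=
  A.pay c s i - (A.purchase c s i : ℝ) * ci

/-- Seller `i`'s expected utility with true cost `ci` from reporting `r`, when the other sellers
report truthfully. -/
def interimUtility {K : ℕ} {S : Type} [MeasurableSpace S] (ρ : Measure S) (A : Mechanism K S)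
    (i : Fin K) (ci r : ℝ) : ℝ :=
  ∫ x, A.sellerUtility i ci (Function.update x.1 i r) x.2 ∂(E.costSeedLaw K ρ)

/-- Feasibility for the mechanism design problem: the weights form a convex combination, the
expected purchases and payments are well defined, and the mechanism is Bayesian incentive
compatible and interim individually rational. -/
structure IsFeasible {K : ℕ} {S : Type} [MeasurableSpace S] (ρ : Measure S)
    (A : Mechanism K S) : Prop where
  weight_sum : ∀ c s, ∑ i, A.weight c s i = 1
  measurable_purchase : ∀ i, Measurable fun x : (Fin K → ℝ) × S => A.purchase x.1 x.2 i
  measurable_pay : ∀ i, Measurable fun x : (Fin K → ℝ) × S => A.pay x.1 x.2 i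
  measurable_weight : ∀ i, Measurable fun x : (Fin K → ℝ) × S => A.weight x.1 x.2 i
  integrable_pay : ∀ i, Integrable (fun x => A.pay x.1 x.2 i) (E.costSeedLaw K ρ)
  integrable_purchase_interim : ∀ i, ∀ r ∈ Set.Icc E.cmin E.cmax,
    Integrable (fun x => (A.purchase (Function.update x.1 i r) x.2 i : ℝ)) (E.costSeedLaw K ρ)
  integrable_pay_interim : ∀ i, ∀ r ∈ Set.Icc E.cmin E.cmax,
    Integrable (fun x => A.pay (Function.update x.1 i r) x.2 i) (E.costSeedLaw K ρ)
  incentive_compatible : ∀ i, ∀ ci ∈ Set.Icc E.cmin E.cmax, ∀ r ∈ Set.Icc E.cmin E.cmax,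
    E.interimUtility ρ A i ci r ≤ E.interimUtility ρ A i ci ci
  individually_rational : ∀ i, ∀ ci ∈ Set.Icc E.cmin E.cmax, 0 ≤ E.interimUtility ρ A i ci ci

/-- The expected buyer cost (the negative of the buyer's utility), at truthful reports:
expected estimator variance plus `lam` times the expected total payment. -/
def buyerCost {K : ℕ} {S : Type} [MeasurableSpace S] (ρ : Measure S) (p : Fin K → ℝ)
    (A : Mechanism K S) : EReal :=
  ((∫⁻ x, E.estimatorVar p (A.purchase x.1 x.2) (A.weight x.1 x.2) ∂(E.costSeedLaw K ρ) : ℝ≥0∞)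
      : EReal)
    + ((E.lam * ∫ x, ∑ i, A.pay x.1 x.2 i ∂(E.costSeedLaw K ρ) : ℝ) : EReal)

/-- `A` is a `ζ`-approximate solution of the mechanism design problem at beliefs `p`: it is
feasible, and its expected buyer cost is at most `1 + ζ` times that of every feasible
mechanism. -/
def IsApproxSolution {K : ℕ} {S : Type} [MeasurableSpace S] (ρ : Measure S) (ζ : ℝ)
    (p : Fin K → ℝ) (A : Mechanism K S) : Prop :=
  E.IsFeasible ρ A ∧
    ∀ (S' : Type) [MeasurableSpace S'] (ρ' : Measure S') [IsProbabilityMeasure ρ']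
      (B : Mechanism K S'), E.IsFeasible ρ' B →
        E.buyerCost ρ p A ≤ ((1 + ζ : ℝ) : EReal) * E.buyerCost ρ' p B

/-! ### The single-sourcing mechanism -/

/-- The belief-adjusted virtual cost `σ̄² ψ(c)`. -/
def costIndex (p c : ℝ) : ℝ := E.meanVar p * E.virtualCost c

/-- Seller `i` is selected: it minimizes the belief-adjusted virtual cost, and is ranked first
among the minimizers. -/
def IsSelected {K : ℕ} (p c : Fin K → ℝ) (s : Ranking K) (i : Fin K) : Prop :=
  ∀ j, E.costIndex (p i) (c i) < E.costIndex (p j) (c j) ∨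
    (E.costIndex (p i) (c i) = E.costIndex (p j) (c j) ∧ s i ≤ s j)

open Classical in
/-- The selected seller sells `⌊σ̄ / √(lam ψ(c))⌋` samples, all others none. -/
def sourcePurchase {K : ℕ} (p c : Fin K → ℝ) (s : Ranking K) (i : Fin K) : ℕ :=
  if E.IsSelected p c s i then
    ⌊√(E.meanVar (p i)) / √(E.lam * E.virtualCost (c i))⌋₊
  else 0

open Classical in
/-- The single-sourcing mechanism at beliefs `p`: the purchases above, the Myerson payments
`cᵢ nᵢ(c) + ∫_{cᵢ}^{cmax} nᵢ(z, c₋ᵢ) dz`, and all weight on the selected seller. -/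
def singleSourcing {K : ℕ} (p : Fin K → ℝ) : Mechanism K (Ranking K) where
  purchase c s i := E.sourcePurchase p c s i
  pay c s i := c i * (E.sourcePurchase p c s i : ℝ)
    + ∫ z in (c i)..E.cmax, (E.sourcePurchase p (Function.update c i z) s i : ℝ)
  weight c s i := if E.IsSelected p c s i then 1 else 0

/-! ### The free-sample stage -/

/-- The law of `m` i.i.d. `N(θ, σ²)` samples. -/
def normalSamples (θ σ : ℝ) (m : ℕ) : Measure (Fin m → ℝ) :=
  Measure.pi fun _ : Fin m => gaussianReal θ (Real.toNNReal (σ ^ 2))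

/-- The unconditional law of a seller's `m` free samples: the seller's standard deviation is
`sigL` with probability `mu` and `sigH` otherwise. -/
def freeSampleLaw (θ : ℝ) (m : ℕ) : Measure (Fin m → ℝ) :=
  ENNReal.ofReal E.mu • normalSamples θ E.sigL m +
    ENNReal.ofReal (1 - E.mu) • normalSamples θ E.sigH m

/-- The likelihood of the value `v` of the sample variance: the density at `v` of the sampling
distribution of the sample variance of `m` i.i.d. `N(θ, σ²)` samples. -/
def likelihood (θ σ : ℝ) (m : ℕ) (v : ℝ) : ℝ :=
  (((normalSamples θ σ m).map sampleVar).rnDeriv volume v).toReal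

/-- The buyer's belief (probability of the high variance) after seeing the free samples `x`, by
Bayes' rule from their sample variance; without a sample variance it is the prior. -/
def belief (θ : ℝ) {m : ℕ} (x : Fin m → ℝ) : ℝ :=
  if m < 2 then 1 - E.mu
  else (1 - E.mu) * likelihood θ E.sigH m (sampleVar x) /
    (E.mu * likelihood θ E.sigL m (sampleVar x) +
      (1 - E.mu) * likelihood θ E.sigH m (sampleVar x))

/-- The possible numbers of free samples: `0, 2, 3, …, M`. -/
def freeSizes : Set ℕ := {m | m ≤ E.M ∧ m ≠ 1}

/-- Seller `i`'s ex-ante payoff when the sellers commit to `m` free samples and the buyer uses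
mechanism `A p` at beliefs `p`: the expectation, over free samples, costs and seed, of the utility
at truthful reports. -/
def exAntePayoff {K : ℕ} {S : Type} [MeasurableSpace S] (ρ : Measure S)
    (A : (Fin K → ℝ) → Mechanism K S) (θ : ℝ) (m : Fin K → ℕ) (i : Fin K) : ℝ :=
  ∫ y : (∀ j, Fin (m j) → ℝ) × ((Fin K → ℝ) × S),
    (A fun j => E.belief θ (y.1 j)).sellerUtility i (y.2.1 i) y.2.1 y.2.2
    ∂((Measure.pi fun j => E.freeSampleLaw θ (m j)).prod (E.costSeedLaw K ρ))

/-- Given the buyer's policy `A`, the commitments `m` are an equilibrium among the sellers: no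
seller gains by deviating to another number of free samples. -/
def IsSellerEquilibrium {K : ℕ} {S : Type} [MeasurableSpace S] (ρ : Measure S)
    (A : (Fin K → ℝ) → Mechanism K S) (θ : ℝ) (m : Fin K → ℕ) : Prop :=
  (∀ i, m i ∈ E.freeSizes) ∧
    ∀ i, ∀ m' ∈ E.freeSizes,
      E.exAntePayoff ρ A θ (Function.update m i m') i ≤ E.exAntePayoff ρ A θ m i

/-- A `ζ`-approximate subgame perfect equilibrium: at every belief profile the buyer's mechanism
is a `ζ`-approximate solution of the mechanism design problem, and sellers best-respond exactly
in the free-sample stage. -/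
def IsApproxSPE {K : ℕ} {S : Type} [MeasurableSpace S] (ρ : Measure S) (ζ : ℝ)
    (A : (Fin K → ℝ) → Mechanism K S) (θ : ℝ) (m : Fin K → ℕ) : Prop :=
  (∀ p : Fin K → ℝ, (∀ i, p i ∈ Set.Icc (0 : ℝ) 1) → E.IsApproxSolution ρ ζ p (A p)) ∧
    E.IsSellerEquilibrium ρ A θ m

end Market

end

/-! Approximate optimality is a Myerson argument. Incentive compatibility and individual rationality
force the expected payment to each seller to cover its purchases priced at virtual cost
(`Regular.le_expected_pay`); the payments of single-sourcing meet this bound with equality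
(`Regular.expected_pay_singleSourcing`). It remains to minimise, cost profile by cost profile, the
estimator variance plus the virtual expenditure. By AM-GM this is at least `2 √(lam · minⱼ σ̄ⱼ²
ψ(cⱼ))` for all weights and purchases (`costFloor_le`). The minimising seller would attain it with a
real-valued quantity, and rounding down a quantity that is at least `α` costs a factor of at most `α
/ (α - 1)` (`floor_cost_le`).

For the sellers, the likelihood ratio of high to low variance at sample variance `s` with `k`
degrees of freedom is `(sigL / sigH) ^ k` times an increasing exponential in `s`. It is smallest at
`s = 0`, and there strictly smaller for larger `k`. Hence only a seller with `M` free samples can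
bring its index `σ̄² ψ(c)` close to the infimum `bestVar * cmin`; all others stay above `secondVar *
cmin`.

Let `a` sellers offer `M`. A seller offering fewer is selected only if all `a` of them miss a fixed
neighbourhood of the best outcome, so by independence its payoff is at most `C * q ^ a`
(`IsTuned.exAntePayoff_le`). A seller offering `M` against `a` competitors that do so can look at a
window of relative size of order `1 / (a + 1)`: with probability at least one half no such
competitor has a cost there, and the seller itself hits it with polynomially small probability. Its
payoff is at least a constant over `(a + 1) ^ (M + 2)` (`IsTuned.le_exAntePayoff`), which beats `C *
q ^ a` for `a ≥ A₀`.

So `(M, …, M)` is an equilibrium for large `K`. In any other equilibrium, `a ≥ A₀` contradicts this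
comparison for a seller not offering `M`. If `a < A₀`, each of the many sellers not offering `M`
could secure a fixed positive payoff and hence earns it, but total payoffs are bounded since only
the selected seller earns anything. -/

noncomputable section

namespace Market

variable (E : Market)

/-- The regularity assumptions on the cost distribution: monotone virtual cost and a density
bounded away from zero and infinity on the support. -/
structure Regular (ℓ L : ℝ) : Prop where
  mono : MonotoneOn E.virtualCost (Set.Icc E.cmin E.cmax)
  pos : 0 < ℓ
  le_f : ∀ c ∈ Set.Icc E.cmin E.cmax, ℓ ≤ E.f c
  f_le : ∀ c ∈ Set.Icc E.cmin E.cmax, E.f c ≤ L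

/-! ### The cost law, the virtual cost and the mean variance. -/

instance isProbabilityMeasure_costLaw : IsProbabilityMeasure E.costLaw :=
  ⟨by simp [costLaw, E.f_lintegral]⟩

lemma ae_mem_support : ∀ᵐ c ∂E.costLaw, c ∈ Set.Icc E.cmin E.cmax := by
  rw [costLaw, ae_withDensity_iff (by have := E.f_measurable; fun_prop)]
  refine ae_of_all _ fun c hc => ?_
  by_contra h
  exact hc (by simp [E.f_support c h])

instance nullSingletonClass_costLaw : NullSingletonClass E.costLaw := by
  unfold costLaw; infer_instance

lemma Regular.lower_le_upper {E : Market} {ℓ L : ℝ} (h : E.Regular ℓ L) : ℓ ≤ L :=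
  (h.le_f _ (Set.left_mem_Icc.2 E.cmin_lt_cmax.le)).trans
    (h.f_le _ (Set.left_mem_Icc.2 E.cmin_lt_cmax.le))

lemma Regular.pos_L {E : Market} {ℓ L : ℝ} (h : E.Regular ℓ L) : 0 < L := h.pos.trans_le h.lower_le_upper

lemma Regular.f_le_all {E : Market} {ℓ L : ℝ} (h : E.Regular ℓ L) (c : ℝ) : E.f c ≤ L := by
  by_cases hc : c ∈ Set.Icc E.cmin E.cmax
  · exact h.f_le c hc
  · rw [E.f_support c hc]; exact h.pos_L.le

lemma Regular.costLaw_Icc_le {E : Market} {ℓ L : ℝ} (h : E.Regular ℓ L) {a b : ℝ} (hab : a ≤ b) :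
    E.costLaw.real (Set.Icc a b) ≤ L * (b - a) := by
  have : E.costLaw (Set.Icc a b) ≤ ENNReal.ofReal (L * (b - a)) := by
    rw [costLaw, withDensity_apply _ measurableSet_Icc]
    calc ∫⁻ c in Set.Icc a b, ENNReal.ofReal (E.f c)
        ≤ ∫⁻ _ in Set.Icc a b, ENNReal.ofReal L :=
          lintegral_mono fun c => ENNReal.ofReal_le_ofReal (h.f_le_all c)
      _ = _ := by simp [ENNReal.ofReal_mul h.pos_L.le]
  exact ENNReal.toReal_le_of_le_ofReal (mul_nonneg h.pos_L.le (by linarith)) this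

lemma Regular.le_costLaw_Icc {E : Market} {ℓ L : ℝ} (h : E.Regular ℓ L) {a b : ℝ}
    (ha : E.cmin ≤ a) (hb : b ≤ E.cmax) :
    ℓ * (b - a) ≤ E.costLaw.real (Set.Icc a b) := by
  have : ENNReal.ofReal (ℓ * (b - a)) ≤ E.costLaw (Set.Icc a b) := by
    rw [costLaw, withDensity_apply _ measurableSet_Icc]
    calc ENNReal.ofReal (ℓ * (b - a)) = ∫⁻ _ in Set.Icc a b, ENNReal.ofReal ℓ := by
          simp [ENNReal.ofReal_mul h.pos.le]
      _ ≤ ∫⁻ c in Set.Icc a b, ENNReal.ofReal (E.f c) :=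
          setLIntegral_mono' measurableSet_Icc fun c hc =>
            ENNReal.ofReal_le_ofReal (h.le_f c ⟨ha.trans hc.1, hc.2.trans hb⟩)
  exact (ENNReal.ofReal_le_iff_le_toReal (measure_ne_top _ _)).1 this

lemma cdf_eq_real_Icc (c : ℝ) : cdf E.costLaw c = E.costLaw.real (Set.Icc E.cmin c) := by
  rw [cdf_eq_real]
  refine measureReal_congr ?_
  filter_upwards [E.ae_mem_support] with x hx
  exact propext ⟨fun h => ⟨hx.1, h⟩, fun h => h.2⟩

lemma le_virtualCost (c : ℝ) : c ≤ E.virtualCost c :=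
  le_add_of_nonneg_right (div_nonneg (cdf_nonneg _ c) (E.f_nonneg c))

/-- Since `F` grows at rate at most `L` and `f ≥ ℓ`, the virtual cost leaves its minimum `cmin` at
most linearly. This turns a nearly minimal cost into a nearly minimal index. -/
lemma Regular.virtualCost_le {E : Market} {ℓ L : ℝ} (h : E.Regular ℓ L) {c : ℝ}
    (hc : c ∈ Set.Icc E.cmin E.cmax) :
    E.virtualCost c ≤ E.cmin + (1 + L / ℓ) * (c - E.cmin) := by
  have h1 : cdf E.costLaw c ≤ L * (c - E.cmin) := by
    rw [cdf_eq_real_Icc]; exact h.costLaw_Icc_le hc.1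
  have h2 : cdf E.costLaw c / E.f c ≤ L * (c - E.cmin) / ℓ :=
    div_le_div₀ (mul_nonneg h.pos_L.le (by linarith [hc.1])) h1 h.pos (h.le_f c hc)
  have h3 : (1 + L / ℓ) * (c - E.cmin) = c - E.cmin + L * (c - E.cmin) / ℓ := by ring
  rw [virtualCost]
  linarith

lemma virtualCost_pos {c : ℝ} (hc : E.cmin ≤ c) : 0 < E.virtualCost c :=
  E.cmin_pos.trans_le (hc.trans (E.le_virtualCost c))

@[fun_prop]
lemma measurable_virtualCost : Measurable E.virtualCost := by
  have h1 : Measurable fun c => cdf E.costLaw c := (monotone_cdf _).measurable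
  have h2 := E.f_measurable
  unfold virtualCost
  fun_prop

lemma meanVar_mem {p : ℝ} (hp : p ∈ Set.Icc (0 : ℝ) 1) :
    E.meanVar p ∈ Set.Icc (E.sigL ^ 2) (E.sigH ^ 2) := by
  have h : E.sigL ^ 2 ≤ E.sigH ^ 2 := pow_le_pow_left₀ E.sigL_pos.le E.sigL_lt_sigH.le 2
  constructor <;> unfold meanVar <;> nlinarith [hp.1, hp.2]

lemma sigL_sq_lt : E.sigL ^ 2 < E.sigH ^ 2 :=
  pow_lt_pow_left₀ E.sigL_lt_sigH E.sigL_pos.le two_ne_zero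

lemma meanVar_pos {p : ℝ} (hp : p ∈ Set.Icc (0 : ℝ) 1) : 0 < E.meanVar p :=
  (pow_pos E.sigL_pos 2).trans_le (E.meanVar_mem hp).1

lemma meanVar_strictMono : StrictMono E.meanVar := by
  intro p q hpq
  have := E.sigL_sq_lt
  unfold meanVar; nlinarith

@[fun_prop]
lemma measurable_meanVar : Measurable E.meanVar := by unfold meanVar; fun_prop

end Market

/-! ### Resampling one coordinate -/

/-- A fresh independent draw in one coordinate leaves an i.i.d. product invariant. This links
ex-ante integrals to interim ones, where one report is held fixed. -/
lemma measurePreserving_update_pi {K : ℕ} (μ : Measure ℝ) [IsProbabilityMeasure μ] (i : Fin K) :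
    MeasurePreserving (fun y : ℝ × (Fin K → ℝ) => Function.update y.2 i y.1)
      (μ.prod (Measure.pi fun _ => μ)) (Measure.pi fun _ => μ) := by
  have hm : Measurable fun y : ℝ × (Fin K → ℝ) => Function.update y.2 i y.1 := by
    refine measurable_pi_lambda _ fun j => ?_
    by_cases h : j = i
    · subst h; simpa using measurable_fst
    · simp only [Function.update_of_ne h]; fun_prop
  refine ⟨hm, ?_⟩
  refine (Measure.pi_eq fun s hs => ?_).symm
  rw [Measure.map_apply hm (MeasurableSet.univ_pi hs)]
  have : (fun y : ℝ × (Fin K → ℝ) => Function.update y.2 i y.1) ⁻¹' Set.univ.pi s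
      = s i ×ˢ Set.univ.pi (Function.update s i Set.univ) := by
    ext y
    simp only [Set.mem_preimage, Set.mem_pi, Set.mem_univ, true_implies, Set.mem_prod]
    constructor
    · intro h
      refine ⟨by simpa using h i, fun j => ?_⟩
      by_cases hj : j = i
      · subst hj; simp
      · simpa [Function.update_of_ne hj] using h j
    · rintro ⟨h1, h2⟩ j
      by_cases hj : j = i
      · subst hj; simpa using h1
      · simpa [Function.update_of_ne hj] using h2 j
  rw [this, Measure.prod_prod, Measure.pi_pi, ← Finset.mul_prod_erase _ _ (Finset.mem_univ i),
    ← Finset.mul_prod_erase Finset.univ (fun j => μ (s j)) (Finset.mem_univ i)]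
  simp only [Function.update_self, measure_univ, one_mul]
  congr 1
  refine Finset.prod_congr rfl fun j hj => ?_
  rw [Function.update_of_ne (Finset.ne_of_mem_erase hj)]

namespace Market

variable (E : Market)

instance {K : ℕ} {S : Type} [MeasurableSpace S] (ρ : Measure S) [IsProbabilityMeasure ρ] :
    IsProbabilityMeasure (E.costSeedLaw K ρ) := by
  unfold costSeedLaw; infer_instance

lemma ae_costSeedLaw {K : ℕ} {S : Type} [MeasurableSpace S] (ρ : Measure S)
    [IsProbabilityMeasure ρ] :
    ∀ᵐ x ∂E.costSeedLaw K ρ, ∀ i, x.1 i ∈ Set.Icc E.cmin E.cmax := by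
  rw [ae_all_iff]
  intro i
  exact ((measurePreserving_eval (fun _ : Fin K => E.costLaw) i).quasiMeasurePreserving.comp
    (Measure.quasiMeasurePreserving_fst (μ := Measure.pi fun _ : Fin K => E.costLaw)
      (ν := ρ))).ae E.ae_mem_support

/-- Redrawing seller `i`'s cost does not change the joint law. -/
lemma measurePreserving_update {K : ℕ} {S : Type} [MeasurableSpace S] (ρ : Measure S)
    [IsProbabilityMeasure ρ] (i : Fin K) :
    MeasurePreserving (fun y : ℝ × ((Fin K → ℝ) × S) => (Function.update y.2.1 i y.1, y.2.2))
      (E.costLaw.prod (E.costSeedLaw K ρ)) (E.costSeedLaw K ρ) := by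
  have h1 := (measurePreserving_update_pi (K := K) E.costLaw i).prod (MeasurePreserving.id ρ)
  exact h1.comp (measurePreserving_prodAssoc E.costLaw (Measure.pi fun _ : Fin K => E.costLaw)
    ρ).symm

lemma lintegral_update {K : ℕ} {S : Type} [MeasurableSpace S] (ρ : Measure S)
    [IsProbabilityMeasure ρ] (i : Fin K) {g : (Fin K → ℝ) × S → ℝ≥0∞} (hg : Measurable g) :
    ∫⁻ x, g x ∂E.costSeedLaw K ρ =
      ∫⁻ r, ∫⁻ x, g (Function.update x.1 i r, x.2) ∂E.costSeedLaw K ρ ∂E.costLaw := by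
  have h := E.measurePreserving_update ρ i
  rw [← h.lintegral_comp hg]
  exact lintegral_prod _ (hg.comp h.measurable).aemeasurable

end Market

/-- Variable endpoints are absorbed into an indicator on the product space, after which
measurability of parametric integrals applies. Needed for Myerson payments, whose lower endpoint is
the reported cost. -/
lemma Measurable.intervalIntegral_param {Y : Type*} [MeasurableSpace Y] {g : Y → ℝ → ℝ}
    {a b : Y → ℝ} (hg : Measurable fun y : Y × ℝ => g y.1 y.2) (ha : Measurable a)
    (hb : Measurable b) : Measurable fun y => ∫ z in (a y)..(b y), g y z := by
  have key : ∀ {a b : Y → ℝ}, Measurable a → Measurable b →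
      Measurable fun y => ∫ z in Set.Ioc (a y) (b y), g y z := by
    intro a b ha hb
    have hs : MeasurableSet {y : Y × ℝ | a y.1 < y.2 ∧ y.2 ≤ b y.1} :=
      (measurableSet_lt (ha.comp measurable_fst) measurable_snd).inter
        (measurableSet_le measurable_snd (hb.comp measurable_fst))
    have h := (hg.indicator hs).stronglyMeasurable.integral_prod_right' (ν := volume)
    convert h.measurable using 1
    funext y
    rw [← integral_indicator measurableSet_Ioc]
    rfl
  exact (key ha hb).sub (key hb ha)

namespace Market

variable (E : Market) {K : ℕ}

/-! ### Selection -/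

lemma exists_isSelected [NeZero K] (p c : Fin K → ℝ) (s : Ranking K) :
    ∃ i, E.IsSelected p c s i := by
  -- Selection is lexicographic minimisation of the pair (index, rank).
  obtain ⟨i, hi⟩ := Finite.exists_min fun i : Fin K => toLex (E.costIndex (p i) (c i), s i)
  exact ⟨i, fun j => by simpa [Prod.Lex.toLex_le_toLex] using hi j⟩

variable {E} in
lemma IsSelected.le {p c : Fin K → ℝ} {s : Ranking K} {i : Fin K} (h : E.IsSelected p c s i)
    (j : Fin K) : E.costIndex (p i) (c i) ≤ E.costIndex (p j) (c j) := by
  rcases h j with h | h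
  · exact h.le
  · exact h.1.le

variable {E} in
lemma IsSelected.eq {p c : Fin K → ℝ} {s : Ranking K} {i j : Fin K} (hi : E.IsSelected p c s i)
    (hj : E.IsSelected p c s j) : i = j := by
  have h1 := hi j
  have h2 := hj i
  have h3 := hi.le j
  have h4 := hj.le i
  refine s.injective (le_antisymm ?_ ?_)
  · rcases h1 with h | h
    · exact absurd h h4.not_gt
    · exact h.2
  · rcases h2 with h | h
    · exact absurd h h3.not_gt
    · exact h.2

lemma measurableSet_isSelected (i : Fin K) :
    MeasurableSet {y : (Fin K → ℝ) × (Fin K → ℝ) × Ranking K |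
      E.IsSelected y.1 y.2.1 y.2.2 i} := by
  have hidx : ∀ j, Measurable fun y : (Fin K → ℝ) × (Fin K → ℝ) × Ranking K =>
      E.costIndex (y.1 j) (y.2.1 j) := fun j => by unfold costIndex; fun_prop
  have hs : ∀ j, MeasurableSet {y : (Fin K → ℝ) × (Fin K → ℝ) × Ranking K |
      y.2.2 i ≤ y.2.2 j} := fun j =>
    MeasurableSet.preimage (t := {s : Ranking K | s i ≤ s j}) trivial
      (measurable_snd.comp measurable_snd)
  rw [show {y : (Fin K → ℝ) × (Fin K → ℝ) × Ranking K | E.IsSelected y.1 y.2.1 y.2.2 i} =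
      ⋂ j, ({y | E.costIndex (y.1 i) (y.2.1 i) < E.costIndex (y.1 j) (y.2.1 j)} ∪
        ({y | E.costIndex (y.1 i) (y.2.1 i) = E.costIndex (y.1 j) (y.2.1 j)} ∩
          {y | y.2.2 i ≤ y.2.2 j})) by ext y; simp [IsSelected]]
  exact MeasurableSet.iInter fun j => (measurableSet_lt (hidx i) (hidx j)).union
    ((measurableSet_eq_fun (hidx i) (hidx j)).inter (hs j))

/-- The number of samples bought from the selected seller. -/
def quantity (p c : ℝ) : ℕ := ⌊√(E.meanVar p) / √(E.lam * E.virtualCost c)⌋₊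

open Classical in
lemma sourcePurchase_eq (p c : Fin K → ℝ) (s : Ranking K) (i : Fin K) :
    E.sourcePurchase p c s i = if E.IsSelected p c s i then E.quantity (p i) (c i) else 0 := rfl

lemma sourcePurchase_le (p c : Fin K → ℝ) (s : Ranking K) (i : Fin K) :
    E.sourcePurchase p c s i ≤ E.quantity (p i) (c i) := by
  classical
  rw [sourcePurchase_eq]; split_ifs <;> simp

lemma measurable_sourcePurchase (i : Fin K) :
    Measurable fun y : (Fin K → ℝ) × (Fin K → ℝ) × Ranking K =>
      E.sourcePurchase y.1 y.2.1 y.2.2 i := by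
  classical
  simp only [sourcePurchase_eq]
  refine Measurable.ite (E.measurableSet_isSelected i) ?_ measurable_const
  unfold quantity
  refine Nat.measurable_floor.comp ?_
  fun_prop

lemma measurable_sourcePurchase_comp {Y : Type*} [MeasurableSpace Y] (i : Fin K)
    {p c : Y → Fin K → ℝ} {s : Y → Ranking K} (hp : Measurable p) (hc : Measurable c)
    (hs : Measurable s) : Measurable fun y => E.sourcePurchase (p y) (c y) (s y) i :=
  (E.measurable_sourcePurchase i).comp (hp.prodMk (hc.prodMk hs))

lemma measurable_update_param {Y : Type*} [MeasurableSpace Y] (i : Fin K) {c : Y → Fin K → ℝ}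
    {z : Y → ℝ} (hc : Measurable c) (hz : Measurable z) :
    Measurable fun y => Function.update (c y) i (z y) := by
  refine measurable_pi_lambda _ fun j => ?_
  by_cases h : j = i
  · subst h; simpa using hz
  · simp only [Function.update_of_ne h]; fun_prop

lemma measurable_pay_comp {Y : Type*} [MeasurableSpace Y] (i : Fin K)
    {p c : Y → Fin K → ℝ} {s : Y → Ranking K} (hp : Measurable p) (hc : Measurable c)
    (hs : Measurable s) : Measurable fun y => (E.singleSourcing (p y)).pay (c y) (s y) i := by
  have hn := E.measurable_sourcePurchase_comp i hp hc hs
  have hn' := E.measurable_sourcePurchase_comp (Y := Y × ℝ) i (hp.comp measurable_fst)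
    (measurable_update_param i (hc.comp measurable_fst) measurable_snd) (hs.comp measurable_fst)
  have h1 : Measurable fun n : ℕ => (n : ℝ) := measurable_from_top
  have hI := Measurable.intervalIntegral_param (a := fun y => c y i) (b := fun _ => E.cmax)
    (g := fun y z => (E.sourcePurchase (p y) (Function.update (c y) i z) (s y) i : ℝ))
    (h1.comp hn') (by fun_prop) measurable_const
  exact (Measurable.mul (by fun_prop) (h1.comp hn)).add hI

/-! ### Bounds on purchases -/

/-- An upper bound on the number of samples bought. -/
def purchaseBound : ℝ := E.sigH / √(E.lam * E.cmin)

lemma purchaseBound_nonneg : 0 ≤ E.purchaseBound :=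
  div_nonneg (E.sigL_pos.trans E.sigL_lt_sigH).le (Real.sqrt_nonneg _)

lemma quantity_le {p c : ℝ} (hp : p ∈ Set.Icc (0 : ℝ) 1) (hc : E.cmin ≤ c) :
    (E.quantity p c : ℝ) ≤ E.purchaseBound := by
  have h0 : 0 < E.lam * E.cmin := mul_pos E.lam_pos E.cmin_pos
  have hH : 0 < E.sigH := E.sigL_pos.trans E.sigL_lt_sigH
  refine (Nat.floor_le (by positivity)).trans ?_
  refine div_le_div₀ hH.le ?_ (Real.sqrt_pos.2 h0) (Real.sqrt_le_sqrt ?_)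
  · rw [Real.sqrt_le_left hH.le]; exact (E.meanVar_mem hp).2
  · exact mul_le_mul_of_nonneg_left (hc.trans (E.le_virtualCost c)) E.lam_pos.le

lemma sourcePurchase_le_bound {p c : Fin K → ℝ} {s : Ranking K} {i : Fin K}
    (hp : p i ∈ Set.Icc (0 : ℝ) 1) (hc : E.cmin ≤ c i) :
    (E.sourcePurchase p c s i : ℝ) ≤ E.purchaseBound :=
  (Nat.cast_le.2 (E.sourcePurchase_le p c s i)).trans (E.quantity_le hp hc)

variable {E} in
lemma Regular.quantity_antitone {ℓ L : ℝ} (h : E.Regular ℓ L) (p : ℝ) :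
    AntitoneOn (E.quantity p) (Set.Icc E.cmin E.cmax) := by
  intro a ha b hb hab
  refine Nat.floor_le_floor (div_le_div_of_nonneg_left (Real.sqrt_nonneg _) ?_ ?_)
  · exact Real.sqrt_pos.2 (mul_pos E.lam_pos (E.virtualCost_pos ha.1))
  · exact Real.sqrt_le_sqrt (mul_le_mul_of_nonneg_left (h.mono ha hb hab) E.lam_pos.le)

-- A lower own cost lowers only the own index, while the ranking and the other indices stay fixed.
-- This is where monotonicity of the virtual cost enters the incentives.
variable {E} in
lemma Regular.isSelected_antitone {ℓ L : ℝ} (h : E.Regular ℓ L) {p c : Fin K → ℝ}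
    {s : Ranking K} {i : Fin K} (hp : p i ∈ Set.Icc (0 : ℝ) 1) {a b : ℝ}
    (ha : a ∈ Set.Icc E.cmin E.cmax) (hb : b ∈ Set.Icc E.cmin E.cmax) (hab : a ≤ b)
    (hsel : E.IsSelected p (Function.update c i b) s i) :
    E.IsSelected p (Function.update c i a) s i := by
  have hidx : E.costIndex (p i) a ≤ E.costIndex (p i) b :=
    mul_le_mul_of_nonneg_left (h.mono ha hb hab) (E.meanVar_pos hp).le
  intro j
  by_cases hj : j = i
  · subst hj; exact Or.inr ⟨rfl, le_rfl⟩
  · have := hsel j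
    simp only [Function.update_self, Function.update_of_ne hj] at this ⊢
    rcases this with h1 | h1
    · exact Or.inl (hidx.trans_lt h1)
    · rcases hidx.lt_or_eq with h2 | h2
      · exact Or.inl (h2.trans_eq h1.1)
      · exact Or.inr ⟨h2.trans h1.1, h1.2⟩

variable {E} in
lemma Regular.sourcePurchase_antitone {ℓ L : ℝ} (h : E.Regular ℓ L) {p c : Fin K → ℝ}
    {s : Ranking K} {i : Fin K} (hp : p i ∈ Set.Icc (0 : ℝ) 1) :
    AntitoneOn (fun z => (E.sourcePurchase p (Function.update c i z) s i : ℝ))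
      (Set.Icc E.cmin E.cmax) := by
  classical
  intro a ha b hb hab
  simp only [Nat.cast_le]
  rw [sourcePurchase_eq, sourcePurchase_eq]
  split_ifs with h1 h2
  · simpa using h.quantity_antitone (p i) ha hb hab
  · exact absurd (h.isSelected_antitone hp ha hb hab h1) h2
  · exact Nat.zero_le _
  · exact le_rfl

lemma weight_sum [NeZero K] (p c : Fin K → ℝ) (s : Ranking K) :
    ∑ i, (E.singleSourcing p).weight c s i = 1 := by
  classical
  obtain ⟨i, hi⟩ := E.exists_isSelected p c s
  rw [Finset.sum_eq_single i]
  · simp [singleSourcing, hi]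
  · intro j _ hj
    have : ¬E.IsSelected p c s j := fun h => hj (h.eq hi)
    simp [singleSourcing, this]
  · simp

/-! ### Incentives -/

lemma sellerUtility_update (p c : Fin K → ℝ) (s : Ranking K) (i : Fin K) (ci r : ℝ) :
    (E.singleSourcing p).sellerUtility i ci (Function.update c i r) s =
      (r - ci) * (E.sourcePurchase p (Function.update c i r) s i : ℝ)
        + ∫ z in r..E.cmax, (E.sourcePurchase p (Function.update c i z) s i : ℝ) := by
  simp only [Mechanism.sellerUtility, singleSourcing, Function.update_self,
    Function.update_idem]
  ring

lemma sellerUtility_truthful (p c : Fin K → ℝ) (s : Ranking K) (i : Fin K) :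
    (E.singleSourcing p).sellerUtility i (c i) c s =
      ∫ z in (c i)..E.cmax, (E.sourcePurchase p (Function.update c i z) s i : ℝ) := by
  have := E.sellerUtility_update p c s i (c i) (c i)
  simpa using this

end Market

/-- Comparison of areas: reporting `r` instead of `a` replaces the area under `n` between `a` and
`r` by the rectangle of height `n r`, which is unfavourable on either side because `n` decreases. -/
lemma AntitoneOn.mul_sub_add_integral_le {n : ℝ → ℝ} {A B : ℝ} (hn : AntitoneOn n (Set.Icc A B))
    {a r : ℝ} (ha : a ∈ Set.Icc A B) (hr : r ∈ Set.Icc A B) :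
    (r - a) * n r + ∫ z in r..B, n z ≤ ∫ z in a..B, n z := by
  have hint : ∀ {x y : ℝ}, x ∈ Set.Icc A B → y ∈ Set.Icc A B → IntervalIntegrable n volume x y :=
    fun hx hy => (hn.mono (Set.uIcc_subset_Icc hx hy)).intervalIntegrable
  have hB : B ∈ Set.Icc A B := ⟨ha.1.trans ha.2, le_rfl⟩
  rw [← intervalIntegral.integral_add_adjacent_intervals (hint ha hr) (hint hr hB)]
  gcongr
  rcases le_total a r with har | har
  · have := intervalIntegral.integral_mono_on har (intervalIntegrable_const (c := n r)) (hint ha hr)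
      fun z hz => hn ⟨ha.1.trans hz.1, hz.2.trans hr.2⟩ hr hz.2
    simpa using this
  · have := intervalIntegral.integral_mono_on har (hint hr ha) (intervalIntegrable_const (c := n r))
      fun z hz => hn hr ⟨hr.1.trans hz.1, hz.2.trans ha.2⟩ hz.1
    rw [intervalIntegral.integral_symm]
    simp at this
    linarith

namespace Market

variable {E : Market} {K : ℕ}

/-- Truth-telling is optimal for each realisation of the other costs and the seed, so the Bayesian
constraint follows by integration. -/
lemma sellerUtility_le_truthful {ℓ L : ℝ} (h : E.Regular ℓ L) {p c : Fin K → ℝ}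
    {s : Ranking K} {i : Fin K} (hp : p i ∈ Set.Icc (0 : ℝ) 1) {ci r : ℝ}
    (hci : ci ∈ Set.Icc E.cmin E.cmax) (hr : r ∈ Set.Icc E.cmin E.cmax) :
    (E.singleSourcing p).sellerUtility i ci (Function.update c i r) s ≤
      (E.singleSourcing p).sellerUtility i ci (Function.update c i ci) s := by
  rw [sellerUtility_update, sellerUtility_update, sub_self, zero_mul, zero_add]
  exact (h.sourcePurchase_antitone hp).mul_sub_add_integral_le hci hr

variable (E) in
lemma integral_purchase_nonneg (p c : Fin K → ℝ) (s : Ranking K) (i : Fin K) {a : ℝ}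
    (ha : a ≤ E.cmax) :
    0 ≤ ∫ z in a..E.cmax, (E.sourcePurchase p (Function.update c i z) s i : ℝ) :=
  intervalIntegral.integral_nonneg ha fun _ _ => Nat.cast_nonneg _

lemma integral_purchase_le {ℓ L : ℝ} (h : E.Regular ℓ L) {p c : Fin K → ℝ} {s : Ranking K}
    {i : Fin K} (hp : p i ∈ Set.Icc (0 : ℝ) 1) {a : ℝ} (ha : a ∈ Set.Icc E.cmin E.cmax) :
    ∫ z in a..E.cmax, (E.sourcePurchase p (Function.update c i z) s i : ℝ)
      ≤ E.purchaseBound * (E.cmax - E.cmin) := by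
  have h1 := intervalIntegral.integral_mono_on (μ := volume) ha.2
    ((h.sourcePurchase_antitone (c := c) (s := s) hp).mono
      (Set.uIcc_subset_Icc ha ⟨ha.1.trans ha.2, le_rfl⟩)).intervalIntegrable
    (intervalIntegrable_const (c := E.purchaseBound))
    fun z hz => E.sourcePurchase_le_bound hp (by simpa using ha.1.trans hz.1)
  refine h1.trans ?_
  rw [intervalIntegral.integral_const, smul_eq_mul, mul_comm]
  exact mul_le_mul_of_nonneg_left (by linarith [ha.1]) E.purchaseBound_nonneg

lemma norm_pay_le {ℓ L : ℝ} (h : E.Regular ℓ L) {p c : Fin K → ℝ} {s : Ranking K}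
    {i : Fin K} (hp : p i ∈ Set.Icc (0 : ℝ) 1) (hc : c i ∈ Set.Icc E.cmin E.cmax) :
    ‖(E.singleSourcing p).pay c s i‖ ≤
      E.cmax * E.purchaseBound + E.purchaseBound * (E.cmax - E.cmin) := by
  have h0 := E.cmin_pos
  have h1 := E.integral_purchase_nonneg p c s i hc.2
  have h2 := integral_purchase_le h (c := c) (s := s) hp hc
  have h3 := E.sourcePurchase_le_bound (s := s) hp hc.1
  have h4 : (0 : ℝ) ≤ E.sourcePurchase p c s i := Nat.cast_nonneg _
  have h5 : c i * (E.sourcePurchase p c s i : ℝ) ≤ E.cmax * E.purchaseBound :=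
    mul_le_mul hc.2 h3 h4 (h0.le.trans (hc.1.trans hc.2))
  have h6 : 0 ≤ c i * (E.sourcePurchase p c s i : ℝ) := mul_nonneg (h0.le.trans hc.1) h4
  simp only [singleSourcing, Real.norm_eq_abs]
  rw [abs_of_nonneg (by linarith)]
  linarith

instance : IsProbabilityMeasure (rankingLaw K) := by unfold rankingLaw; infer_instance

lemma isFeasible_singleSourcing [NeZero K] {ℓ L : ℝ} (h : E.Regular ℓ L) {p : Fin K → ℝ}
    (hp : ∀ i, p i ∈ Set.Icc (0 : ℝ) 1) : E.IsFeasible (rankingLaw K) (E.singleSourcing p) := by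
  classical
  have hcast : Measurable fun n : ℕ => (n : ℝ) := measurable_from_top
  have hn : ∀ i, ∀ r ∈ Set.Icc E.cmin E.cmax, Integrable (fun x : (Fin K → ℝ) × Ranking K =>
      ((E.singleSourcing p).purchase (Function.update x.1 i r) x.2 i : ℝ))
      (E.costSeedLaw K (rankingLaw K)) := by
    intro i r hr
    refine Integrable.of_bound (C := E.purchaseBound) (hcast.comp
      (E.measurable_sourcePurchase_comp i measurable_const
        (measurable_update_param i measurable_fst measurable_const)
        measurable_snd)).aestronglyMeasurable (ae_of_all _ fun x => ?_)
    rw [Real.norm_of_nonneg (Nat.cast_nonneg _)]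
    exact E.sourcePurchase_le_bound (hp i) (by simpa using hr.1)
  have ht : ∀ i, ∀ r ∈ Set.Icc E.cmin E.cmax, Integrable (fun x : (Fin K → ℝ) × Ranking K =>
      (E.singleSourcing p).pay (Function.update x.1 i r) x.2 i)
      (E.costSeedLaw K (rankingLaw K)) := by
    intro i r hr
    refine Integrable.of_bound (E.measurable_pay_comp i measurable_const
        (measurable_update_param i measurable_fst measurable_const)
        measurable_snd).aestronglyMeasurable
      (E.cmax * E.purchaseBound + E.purchaseBound * (E.cmax - E.cmin)) (ae_of_all _ fun x => ?_)
    exact norm_pay_le (c := Function.update x.1 i r) (s := x.2) h (hp i) (by simpa using hr)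
  have hu : ∀ i, ∀ ci, ∀ r ∈ Set.Icc E.cmin E.cmax, Integrable
      (fun x : (Fin K → ℝ) × Ranking K =>
        (E.singleSourcing p).sellerUtility i ci (Function.update x.1 i r) x.2)
      (E.costSeedLaw K (rankingLaw K)) := fun i ci r hr =>
    (ht i r hr).sub ((hn i r hr).mul_const ci)
  refine ⟨fun c s => E.weight_sum p c s, fun i => ?_, fun i => ?_, fun i => ?_, fun i => ?_,
    hn, ht, fun i ci hci r hr => ?_, fun i ci hci => ?_⟩
  · exact E.measurable_sourcePurchase_comp i measurable_const measurable_fst measurable_snd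
  · exact E.measurable_pay_comp i measurable_const measurable_fst measurable_snd
  · refine Measurable.ite ?_ measurable_const measurable_const
    exact (E.measurableSet_isSelected i).preimage
      (measurable_const.prodMk (measurable_fst.prodMk measurable_snd))
  · refine Integrable.of_bound (E.measurable_pay_comp i measurable_const measurable_fst
        measurable_snd).aestronglyMeasurable
        (E.cmax * E.purchaseBound + E.purchaseBound * (E.cmax - E.cmin)) ?_
    filter_upwards [E.ae_costSeedLaw (rankingLaw K)] with x hx
    exact norm_pay_le h (hp i) (hx i)
  · exact integral_mono (hu i ci r hr) (hu i ci ci hci)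
      fun x => sellerUtility_le_truthful h (hp i) hci hr
  · refine integral_nonneg fun x => ?_
    simp only [sellerUtility_update, sub_self, zero_mul, zero_add]
    exact E.integral_purchase_nonneg _ _ _ _ hci.2

end Market

/-! ### Myerson's bound: expected payments cover virtual costs. -/

/-- Telescoping: increments of second order vanish in the limit of fine partitions. -/
lemma le_of_sub_le_sub_mul {D Q : ℝ → ℝ} {A B : ℝ}
    (h : ∀ a ∈ Set.Icc A B, ∀ b ∈ Set.Icc A B, a ≤ b → D a - D b ≤ (Q a - Q b) * (b - a))
    (hAB : A ≤ B) : D A ≤ D B := by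
  have key : ∀ N : ℕ, D A - D B ≤ (Q A - Q B) * (B - A) * ((N : ℝ) + 1)⁻¹ := by
    intro N
    have hN : (0 : ℝ) < (N : ℝ) + 1 := by positivity
    set δ := (B - A) / ((N : ℝ) + 1) with hδ
    have hδ0 : 0 ≤ δ := div_nonneg (by linarith) hN.le
    have hNδ : ((N : ℝ) + 1) * δ = B - A := by rw [hδ]; field_simp
    -- On the partition of mesh `δ` the factors `Q a - Q b` telescope, leaving a total error of one
    -- factor `δ`, which tends to zero.
    have step : ∀ k : ℕ, k ≤ N + 1 → D A - D (A + k * δ) ≤ (Q A - Q (A + k * δ)) * δ := by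
      intro k
      induction k with
      | zero => intro _; simp
      | succ k ih =>
        intro hk
        have hk' : ((k : ℝ) + 1) ≤ (N : ℝ) + 1 := by exact_mod_cast hk
        have h1 : ((k : ℝ) + 1) * δ ≤ B - A := by
          rw [← hNδ]; exact mul_le_mul_of_nonneg_right hk' hδ0
        have h2 : 0 ≤ (k : ℝ) * δ := by positivity
        have := h (A + k * δ) ⟨by linarith, by linarith⟩ (A + (k + 1) * δ)
          ⟨by linarith, by linarith⟩ (by linarith)
        have ih' := ih (by omega)
        have e : A + (k + 1) * δ - (A + k * δ) = δ := by ring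
        rw [e] at this
        push_cast
        linarith
    have := step (N + 1) le_rfl
    push_cast at this
    rw [hNδ, show A + (B - A) = B by ring] at this
    rw [mul_assoc, ← div_eq_mul_inv]
    exact this
  have hlim : Filter.Tendsto (fun N : ℕ => (Q A - Q B) * (B - A) * ((N : ℝ) + 1)⁻¹)
      Filter.atTop (nhds ((Q A - Q B) * (B - A) * 0)) :=
    (tendsto_inv_atTop_zero.comp
      (Filter.tendsto_atTop_add_const_right _ 1 tendsto_natCast_atTop_atTop)).const_mul _
  have := ge_of_tendsto' hlim key
  linarith [this, mul_zero ((Q A - Q B) * (B - A))]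

namespace Market

variable {E : Market} {K : ℕ}

lemma Regular.f_pos {ℓ L : ℝ} (h : E.Regular ℓ L) {c : ℝ} (hc : c ∈ Set.Icc E.cmin E.cmax) :
    0 < E.f c := h.pos.trans_le (h.le_f c hc)

/-- Exchanging the integrals gives `Q z` the weight `F z`, the probability of a cost below `z`;
written as `(F / f) * f` this is again an integral against the cost law. It is the information-rent
part of the virtual cost. -/
lemma Regular.lintegral_Ioc {ℓ L : ℝ} (h : E.Regular ℓ L) {Q : ℝ → ℝ≥0∞} (hQ : Measurable Q) :
    ∫⁻ r, (∫⁻ z in Set.Ioc r E.cmax, Q z) ∂E.costLaw =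
      ∫⁻ r, ENNReal.ofReal (cdf E.costLaw r / E.f r) * Q r ∂E.costLaw := by
  have hfm := E.f_measurable
  have hcm : Measurable fun c => cdf E.costLaw c := (monotone_cdf _).measurable
  have hs : MeasurableSet {y : ℝ × ℝ | y.1 < y.2 ∧ y.2 ≤ E.cmax} :=
    (measurableSet_lt measurable_fst measurable_snd).inter
      (measurableSet_le measurable_snd measurable_const)
  have hm : Measurable ({y : ℝ × ℝ | y.1 < y.2 ∧ y.2 ≤ E.cmax}.indicator fun y => Q y.2) :=
    (hQ.comp measurable_snd).indicator hs
  calc ∫⁻ r, (∫⁻ z in Set.Ioc r E.cmax, Q z) ∂E.costLaw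
      = ∫⁻ r, (∫⁻ z, {y : ℝ × ℝ | y.1 < y.2 ∧ y.2 ≤ E.cmax}.indicator (fun y => Q y.2) (r, z))
          ∂E.costLaw := by
        refine lintegral_congr fun r => ?_
        rw [← lintegral_indicator measurableSet_Ioc]
        rfl
    _ = ∫⁻ z, (∫⁻ r, {y : ℝ × ℝ | y.1 < y.2 ∧ y.2 ≤ E.cmax}.indicator (fun y => Q y.2) (r, z)
          ∂E.costLaw) :=
        lintegral_lintegral_swap (f := fun r z =>
          {y : ℝ × ℝ | y.1 < y.2 ∧ y.2 ≤ E.cmax}.indicator (fun y => Q y.2) (r, z))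
          hm.aemeasurable
    _ = ∫⁻ z, ENNReal.ofReal (E.f z) * (ENNReal.ofReal (cdf E.costLaw z / E.f z) * Q z) := by
        refine lintegral_congr fun z => ?_
        by_cases hz : z ∈ Set.Icc E.cmin E.cmax
        · have e : ∀ r, {y : ℝ × ℝ | y.1 < y.2 ∧ y.2 ≤ E.cmax}.indicator (fun y => Q y.2) (r, z)
              = (Set.Iio z).indicator (fun _ => Q z) r := by
            intro r
            simp only [Set.indicator, Set.mem_ofPred_eq, Set.mem_Iio, hz.2, and_true]
          simp only [e]
          rw [lintegral_indicator_const measurableSet_Iio, ← mul_assoc,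
            ← ENNReal.ofReal_mul (E.f_nonneg z), mul_div_cancel₀ _ (h.f_pos hz).ne', ofReal_cdf,
            mul_comm, measure_congr Iio_ae_eq_Iic]
        -- Off the support both sides vanish: almost no cost lies below `z < cmin`, and `z > cmax`
        -- lies outside the range of integration.
        · rw [E.f_support z hz, ENNReal.ofReal_zero, zero_mul]
          refine (lintegral_eq_zero_iff (hm.comp (measurable_id.prodMk measurable_const))).2 ?_
          filter_upwards [E.ae_mem_support] with r hr
          refine Set.indicator_of_notMem (fun hrz => hz ?_) _
          exact ⟨hr.1.trans hrz.1.le, hrz.2⟩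
    _ = _ := by
        rw [costLaw, lintegral_withDensity_eq_lintegral_mul _ (by fun_prop) (by fun_prop)]
        rfl

/-- The expected purchase from seller `i` after a report `r`. -/
def interimPurchase (E : Market) {S : Type} [MeasurableSpace S] (ρ : Measure S)
    (A : Mechanism K S) (i : Fin K) (r : ℝ) : ℝ≥0∞ :=
  ∫⁻ x, (A.purchase (Function.update x.1 i r) x.2 i : ℝ≥0∞) ∂E.costSeedLaw K ρ

section

variable {S : Type} [MeasurableSpace S] {ρ : Measure S} [IsProbabilityMeasure ρ]
  {A : Mechanism K S}

lemma measurable_interimPurchase {i : Fin K}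
    (hA : Measurable fun x : (Fin K → ℝ) × S => A.purchase x.1 x.2 i) :
    Measurable (E.interimPurchase ρ A i) := by
  have hc : Measurable fun n : ℕ => (n : ℝ≥0∞) := measurable_from_top
  exact Measurable.lintegral_prod_right'
    ((hc.comp hA).comp (E.measurePreserving_update ρ i).measurable)

/-- Expected purchases at virtual cost, in terms of interim purchases. -/
lemma Regular.lintegral_virtualCost {ℓ L : ℝ} (h : E.Regular ℓ L) {i : Fin K}
    (hA : Measurable fun x : (Fin K → ℝ) × S => A.purchase x.1 x.2 i) :
    ∫⁻ x, ENNReal.ofReal (E.virtualCost (x.1 i)) * (A.purchase x.1 x.2 i : ℝ≥0∞)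
        ∂E.costSeedLaw K ρ =
      ∫⁻ r, (ENNReal.ofReal r * E.interimPurchase ρ A i r
        + ∫⁻ z in Set.Ioc r E.cmax, E.interimPurchase ρ A i z) ∂E.costLaw := by
  have hc : Measurable fun n : ℕ => (n : ℝ≥0∞) := measurable_from_top
  have hQ : Measurable (E.interimPurchase ρ A i) := measurable_interimPurchase hA
  have hn : ∀ r, Measurable fun x : (Fin K → ℝ) × S =>
      (A.purchase (Function.update x.1 i r) x.2 i : ℝ≥0∞) := fun r =>
    (hc.comp hA).comp ((measurable_update_param i measurable_fst measurable_const).prodMk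
      measurable_snd)
  have hv : Measurable fun x : (Fin K → ℝ) × S =>
      ENNReal.ofReal (E.virtualCost (x.1 i)) := by fun_prop
  have hvn : Measurable fun x : (Fin K → ℝ) × S =>
      ENNReal.ofReal (E.virtualCost (x.1 i)) * (A.purchase x.1 x.2 i : ℝ≥0∞) :=
    hv.mul (hc.comp hA)
  rw [E.lintegral_update ρ i hvn, lintegral_add_left (by fun_prop), h.lintegral_Ioc hQ, ← lintegral_add_left (by fun_prop)]
  refine lintegral_congr_ae ?_
  filter_upwards [E.ae_mem_support] with r hr
  simp only [Function.update_self]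
  rw [lintegral_const_mul _ (hn r), ← add_mul, ← ENNReal.ofReal_add
    (E.cmin_pos.le.trans hr.1) (div_nonneg (cdf_nonneg _ r) (E.f_nonneg r))]
  rfl

/-- The expected payment to a seller in a feasible mechanism covers its virtual cost. -/
lemma Regular.le_expected_pay {ℓ L : ℝ} (h : E.Regular ℓ L) (hA : E.IsFeasible ρ A)
    (i : Fin K) :
    0 ≤ ∫ x, A.pay x.1 x.2 i ∂E.costSeedLaw K ρ ∧
    ∫⁻ x, ENNReal.ofReal (E.virtualCost (x.1 i)) * (A.purchase x.1 x.2 i : ℝ≥0∞)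
        ∂E.costSeedLaw K ρ ≤ ENNReal.ofReal (∫ x, A.pay x.1 x.2 i ∂E.costSeedLaw K ρ) := by
  set T : ℝ → ℝ := fun r => ∫ x, A.pay (Function.update x.1 i r) x.2 i ∂E.costSeedLaw K ρ
    with hT
  set Q : ℝ → ℝ := fun r =>
    ∫ x, (A.purchase (Function.update x.1 i r) x.2 i : ℝ) ∂E.costSeedLaw K ρ with hQ
  have hU : ∀ ci, ∀ r ∈ Set.Icc E.cmin E.cmax,
      E.interimUtility ρ A i ci r = T r - Q r * ci := by
    intro ci r hr
    unfold interimUtility Mechanism.sellerUtility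
    rw [integral_sub (hA.integrable_pay_interim i r hr)
      ((hA.integrable_purchase_interim i r hr).mul_const ci), integral_mul_const]
  have hIC : ∀ a ∈ Set.Icc E.cmin E.cmax, ∀ b ∈ Set.Icc E.cmin E.cmax,
      T b - Q b * a ≤ T a - Q a * a := by
    intro a ha b hb
    rw [← hU a b hb, ← hU a a ha]
    exact hA.incentive_compatible i a ha b hb
  have hIR : ∀ a ∈ Set.Icc E.cmin E.cmax, 0 ≤ T a - Q a * a := by
    intro a ha
    rw [← hU a a ha]
    exact hA.individually_rational i a ha
  have hQ0 : ∀ r, 0 ≤ Q r := fun r => integral_nonneg fun _ => Nat.cast_nonneg _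
  -- Adding the two incentive constraints between `a` and `b` gives `(Q b - Q a) * (b - a) ≤ 0`.
  have hanti : AntitoneOn Q (Set.Icc E.cmin E.cmax) := by
    intro a ha b hb hab
    rcases hab.eq_or_lt with rfl | hlt
    · exact le_rfl
    · have h1 := hIC a ha b hb
      have h2 := hIC b hb a ha
      by_contra hcon
      nlinarith [mul_pos (sub_pos.2 (not_le.1 hcon)) (sub_pos.2 hlt)]
  have hint : ∀ {x y : ℝ}, x ∈ Set.Icc E.cmin E.cmax → y ∈ Set.Icc E.cmin E.cmax →
      IntervalIntegrable Q volume x y :=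
    fun hx hy => (hanti.mono (Set.uIcc_subset_Icc hx hy)).intervalIntegrable
  have hmax : E.cmax ∈ Set.Icc E.cmin E.cmax := ⟨E.cmin_lt_cmax.le, le_rfl⟩
  -- Envelope inequality without derivatives. With `U a = T a - Q a * a`, incentive compatibility
  -- gives `U a - U b ≥ Q b * (b - a)`, while `∫ Q` over `[a, b]` is at most `Q a * (b - a)`. The
  -- difference of rent and utility thus has increments of second order, and telescoping to `cmax`,
  -- where `U ≥ 0`, gives the bound.
  have hG : ∀ r ∈ Set.Icc E.cmin E.cmax, r * Q r + ∫ z in r..E.cmax, Q z ≤ T r := by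
    intro r hr
    have := le_of_sub_le_sub_mul (Q := Q) (A := r) (B := E.cmax)
      (D := fun a => (∫ z in a..E.cmax, Q z) - (T a - Q a * a)) (fun a ha b hb hab => ?_) hr.2
    · simp only [intervalIntegral.integral_same] at this
      linarith [hIR _ hmax]
    · have ha' : a ∈ Set.Icc E.cmin E.cmax := ⟨hr.1.trans ha.1, ha.2⟩
      have hb' : b ∈ Set.Icc E.cmin E.cmax := ⟨hr.1.trans hb.1, hb.2⟩
      have e := intervalIntegral.integral_add_adjacent_intervals (hint ha' hb') (hint hb' hmax)
      have h1 := intervalIntegral.integral_mono_on hab (hint ha' hb')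
        (intervalIntegrable_const (c := Q a))
        fun z hz => hanti ha' ⟨ha'.1.trans hz.1, hz.2.trans hb'.2⟩ hz.1
      rw [intervalIntegral.integral_const, smul_eq_mul] at h1
      have h2 := hIC a ha' b hb'
      rw [← e]
      linarith
  have hQe : ∀ r ∈ Set.Icc E.cmin E.cmax,
      E.interimPurchase ρ A i r = ENNReal.ofReal (Q r) := by
    intro r hr
    rw [hQ, ofReal_integral_eq_lintegral_ofReal (hA.integrable_purchase_interim i r hr)
      (ae_of_all _ fun _ => Nat.cast_nonneg _)]
    simp [interimPurchase]
  have hTle : ∀ r ∈ Set.Icc E.cmin E.cmax, ENNReal.ofReal r * E.interimPurchase ρ A i r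
        + ∫⁻ z in Set.Ioc r E.cmax, E.interimPurchase ρ A i z ≤ ENNReal.ofReal (T r) := by
    intro r hr
    have e : ∫⁻ z in Set.Ioc r E.cmax, E.interimPurchase ρ A i z
        = ENNReal.ofReal (∫ z in r..E.cmax, Q z) := by
      rw [intervalIntegral.integral_of_le hr.2,
        ofReal_integral_eq_lintegral_ofReal ((hint hr hmax).1) (ae_of_all _ hQ0)]
      exact setLIntegral_congr_fun measurableSet_Ioc
        fun z hz => hQe z ⟨hr.1.trans hz.1.le, hz.2⟩
    rw [e, hQe r hr, ← ENNReal.ofReal_mul (E.cmin_pos.le.trans hr.1), ← ENNReal.ofReal_add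
      (mul_nonneg (E.cmin_pos.le.trans hr.1) (hQ0 r))
      (intervalIntegral.integral_nonneg hr.2 fun z _ => hQ0 z)]
    exact ENNReal.ofReal_le_ofReal (hG r hr)
  have hT0 : ∀ r ∈ Set.Icc E.cmin E.cmax, 0 ≤ T r := fun r hr =>
    (add_nonneg (mul_nonneg (E.cmin_pos.le.trans hr.1) (hQ0 r))
      (intervalIntegral.integral_nonneg hr.2 fun z _ => hQ0 z)).trans (hG r hr)
  have hmp := E.measurePreserving_update ρ i
  have hpi : Integrable (fun y : ℝ × ((Fin K → ℝ) × S) =>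
      A.pay (Function.update y.2.1 i y.1) y.2.2 i) (E.costLaw.prod (E.costSeedLaw K ρ)) :=
    hmp.integrable_comp_of_integrable (hA.integrable_pay i)
  have hTint : ∫ x, A.pay x.1 x.2 i ∂E.costSeedLaw K ρ = ∫ r, T r ∂E.costLaw := by
    have hm := (hA.integrable_pay i).aestronglyMeasurable
    rw [← hmp.map_eq] at hm
    rw [hT, ← integral_prod _ hpi]
    conv_lhs => rw [← hmp.map_eq]
    exact integral_map hmp.aemeasurable hm
  have hT0' : 0 ≤ᵐ[E.costLaw] T := by
    filter_upwards [E.ae_mem_support] with r hr using hT0 r hr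
  rw [hTint]
  refine ⟨integral_nonneg_of_ae hT0', ?_⟩
  rw [h.lintegral_virtualCost (hA.measurable_purchase i),
    ofReal_integral_eq_lintegral_ofReal hpi.integral_prod_left hT0']
  refine lintegral_mono_ae ?_
  filter_upwards [E.ae_mem_support] with r hr using hTle r hr

end

/-- In the single-sourcing mechanism the expected payment is the expected virtual cost. -/
lemma Regular.expected_pay_singleSourcing {ℓ L : ℝ} (h : E.Regular ℓ L) {p : Fin K → ℝ}
    (hp : ∀ i, p i ∈ Set.Icc (0 : ℝ) 1) [NeZero K] (i : Fin K) :
    ENNReal.ofReal (∫ x, (E.singleSourcing p).pay x.1 x.2 i ∂E.costSeedLaw K (rankingLaw K)) =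
      ∫⁻ x, ENNReal.ofReal (E.virtualCost (x.1 i)) *
        ((E.singleSourcing p).purchase x.1 x.2 i : ℝ≥0∞) ∂E.costSeedLaw K (rankingLaw K) := by
  have hfeas := isFeasible_singleSourcing h hp
  have hc : Measurable fun n : ℕ => (n : ℝ≥0∞) := measurable_from_top
  have hpay := E.measurable_pay_comp (Y := (Fin K → ℝ) × Ranking K) i
    (measurable_const (a := p)) measurable_fst measurable_snd
  rw [ofReal_integral_eq_lintegral_ofReal (hfeas.integrable_pay i),
    h.lintegral_virtualCost (hfeas.measurable_purchase i),
    E.lintegral_update _ i (by fun_prop)]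
  · refine lintegral_congr_ae ?_
    filter_upwards [E.ae_mem_support] with r hr
    have hn : ∀ {Y : Type} [MeasurableSpace Y] {x : Y → (Fin K → ℝ) × Ranking K} {z : Y → ℝ},
        Measurable x → Measurable z → Measurable fun y =>
          (E.sourcePurchase p (Function.update (x y).1 i (z y)) (x y).2 i : ℝ≥0∞) :=
      fun hx hz => hc.comp (E.measurable_sourcePurchase_comp i measurable_const
        (measurable_update_param i (measurable_fst.comp hx) hz) (measurable_snd.comp hx))
    have e : ∀ x : (Fin K → ℝ) × Ranking K,
        ENNReal.ofReal ((E.singleSourcing p).pay (Function.update x.1 i r) x.2 i) =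
        ENNReal.ofReal r * (E.sourcePurchase p (Function.update x.1 i r) x.2 i : ℝ≥0∞) +
        ∫⁻ z in Set.Ioc r E.cmax,
          (E.sourcePurchase p (Function.update x.1 i z) x.2 i : ℝ≥0∞) := by
      intro x
      simp only [singleSourcing, Function.update_self, Function.update_idem]
      rw [ENNReal.ofReal_add (mul_nonneg (E.cmin_pos.le.trans hr.1) (Nat.cast_nonneg _))
        (E.integral_purchase_nonneg _ _ _ _ hr.2), ENNReal.ofReal_mul (E.cmin_pos.le.trans hr.1),
        ENNReal.ofReal_natCast, intervalIntegral.integral_of_le hr.2,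
        ofReal_integral_eq_lintegral_ofReal _ (ae_of_all _ fun _ => Nat.cast_nonneg _)]
      · simp only [ENNReal.ofReal_natCast]
      · exact ((h.sourcePurchase_antitone (c := x.1) (s := x.2) (hp i)).mono
          (Set.uIcc_subset_Icc hr ⟨E.cmin_lt_cmax.le, le_rfl⟩)).intervalIntegrable.1
    have h1 : Measurable fun x : (Fin K → ℝ) × Ranking K =>
        (E.sourcePurchase p (Function.update x.1 i r) x.2 i : ℝ≥0∞) :=
      hn measurable_id measurable_const
    simp only [e]
    rw [lintegral_add_left (h1.const_mul _), lintegral_const_mul _ h1,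
      lintegral_lintegral_swap (hn measurable_fst measurable_snd).aemeasurable]
    rfl
  · filter_upwards [E.ae_costSeedLaw (rankingLaw K)] with x hx
    exact add_nonneg (mul_nonneg (E.cmin_pos.le.trans (hx i).1) (Nat.cast_nonneg _))
      (E.integral_purchase_nonneg _ _ _ _ (hx i).2)

end Market

/-! ### Purchasing cost bounds -/

/-- AM-GM: for `n > 0` the difference of the two sides is `(w √v - √τ n)² / n`. For `n = 0` the
right side is infinite unless `w = 0`. -/
lemma mul_two_sqrt_le (w : ℝ≥0) {v τ : ℝ} (hv : 0 < v) (hτ : 0 < τ) (n : ℕ) :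
    (w : ℝ≥0∞) * ENNReal.ofReal (2 * √(τ * v)) ≤
      (w : ℝ≥0∞) ^ 2 * ENNReal.ofReal v / (n : ℝ≥0∞) + ENNReal.ofReal τ * (n : ℝ≥0∞) := by
  rcases Nat.eq_zero_or_pos n with rfl | hn
  · rcases eq_or_ne w 0 with rfl | hw
    · simp
    · have h : (w : ℝ≥0∞) ^ 2 * ENNReal.ofReal v ≠ 0 := by simp [hw, hv]
      rw [Nat.cast_zero, ENNReal.div_zero h, top_add]
      exact le_top
  · have hn' : (0 : ℝ) < n := by exact_mod_cast hn
    have hw : (w : ℝ≥0∞) = ENNReal.ofReal (w : ℝ) := by simp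
    have hnn : (n : ℝ≥0∞) = ENNReal.ofReal (n : ℝ) := by simp
    rw [hw, hnn, ← ENNReal.ofReal_mul w.coe_nonneg, ← ENNReal.ofReal_pow w.coe_nonneg,
      ← ENNReal.ofReal_mul (by positivity), ← ENNReal.ofReal_div_of_pos hn',
      ← ENNReal.ofReal_mul hτ.le, ← ENNReal.ofReal_add (by positivity) (by positivity)]
    refine ENNReal.ofReal_le_ofReal ?_
    have ha := Real.sq_sqrt hv.le
    have hb := Real.sq_sqrt hτ.le
    have e : (w : ℝ) ^ 2 * v / n + τ * n - w * (2 * √(τ * v))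
        = (w * √v - √τ * n) ^ 2 / n := by
      rw [Real.sqrt_mul hτ.le]
      field_simp
      rw [sub_sq, mul_pow, mul_pow, ha, hb]
      ring
    have : 0 ≤ (w * √v - √τ * n) ^ 2 / (n : ℝ) := by positivity
    linarith

/-- With `x = √v / √τ`, the unrounded quantity `x` costs exactly `2 √(τ v)`, half from each term.
Rounding down lowers the term `τ n` and raises `v / n` by the factor `x / n`, at most `α / (α - 1)`
because `n > x - 1` and `x ≥ α`. -/
lemma floor_cost_le {v τ α : ℝ} (hv : 0 < v) (hτ : 0 < τ) (hα : 1 < α) (h : α * √τ ≤ √v) :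
    1 ≤ ⌊√v / √τ⌋₊ ∧
    v / (⌊√v / √τ⌋₊ : ℝ) + τ * (⌊√v / √τ⌋₊ : ℝ) ≤ (1 + 1 / (α - 1)) * (2 * √(τ * v)) := by
  have hx : 0 < √v := Real.sqrt_pos.2 hv
  have hy : 0 < √τ := Real.sqrt_pos.2 hτ
  have hq : α ≤ √v / √τ := (le_div_iff₀ hy).2 h
  have h1 : 1 ≤ ⌊√v / √τ⌋₊ := Nat.le_floor (by push_cast; linarith)
  refine ⟨h1, ?_⟩
  set n := ⌊√v / √τ⌋₊ with hn
  have hn0 : (0 : ℝ) < n := by exact_mod_cast h1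
  have hle : (n : ℝ) * √τ ≤ √v := (le_div_iff₀ hy).1 (Nat.floor_le (by positivity))
  have hlt : √v < ((n : ℝ) + 1) * √τ := (div_lt_iff₀ hy).1 (Nat.lt_floor_add_one _)
  rw [Real.sqrt_mul hτ.le]
  have hz : 1 + 1 / (α - 1) = α / (α - 1) := by
    have : α - 1 ≠ 0 := by linarith
    field_simp; ring
  have hα1 : 0 < α - 1 := by linarith
  have k1 : √v * (α - 1) ≤ α * (n * √τ) := by nlinarith
  have k2 : √v ≤ (1 + 1 / (α - 1)) * (n * √τ) := by
    rw [hz, div_mul_eq_mul_div, le_div_iff₀ hα1]; exact k1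
  have k3 : v / n ≤ (1 + 1 / (α - 1)) * (√τ * √v) := by
    rw [div_le_iff₀ hn0]
    calc v = √v * √v := (Real.mul_self_sqrt hv.le).symm
      _ ≤ √v * ((1 + 1 / (α - 1)) * (n * √τ)) := mul_le_mul_of_nonneg_left k2 hx.le
      _ = _ := by ring
  have k4 : τ * n ≤ (1 + 1 / (α - 1)) * (√τ * √v) := by
    have hz1 : 1 ≤ 1 + 1 / (α - 1) := le_add_of_nonneg_right (by positivity)
    calc τ * n = √τ * (n * √τ) := by
          rw [mul_comm (n : ℝ), ← mul_assoc, Real.mul_self_sqrt hτ.le]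
      _ ≤ √τ * √v := mul_le_mul_of_nonneg_left hle hy.le
      _ ≤ _ := le_mul_of_one_le_left (by positivity) hz1
  linarith

/-! ### A lower bound on every feasible buyer cost, nearly attained by single-sourcing. -/

namespace Market

variable {E : Market} {K : ℕ}

/-- The lower bound `2 √(lam minⱼ σ̄ⱼ² ψ(cⱼ))` on the cost of a mechanism. -/
def costFloor (E : Market) (p c : Fin K → ℝ) : ℝ≥0∞ :=
  ⨅ j, ENNReal.ofReal (2 * √(E.lam * E.virtualCost (c j) * E.meanVar (p j)))

lemma measurable_costFloor (p : Fin K → ℝ) : Measurable (E.costFloor p) :=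
  Measurable.iInf fun j => by fun_prop

/-- The bound `mul_two_sqrt_le` is linear in the weight, so splitting the sample among sellers
cannot beat the best one: the weights sum to one. -/
lemma costFloor_le {p c : Fin K → ℝ} (hp : ∀ i, p i ∈ Set.Icc (0 : ℝ) 1)
    (hc : ∀ i, E.cmin ≤ c i) (n : Fin K → ℕ) (w : Fin K → ℝ≥0) (hw : ∑ i, w i = 1) :
    E.costFloor p c ≤ E.estimatorVar p n w
      + ∑ i, ENNReal.ofReal E.lam * (ENNReal.ofReal (E.virtualCost (c i)) * (n i : ℝ≥0∞)) := by
  have hw' : ∑ i, (w i : ℝ≥0∞) = 1 := by exact_mod_cast hw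
  calc E.costFloor p c = ∑ i, (w i : ℝ≥0∞) * E.costFloor p c := by
        rw [← Finset.sum_mul, hw', one_mul]
    _ ≤ ∑ i, ((w i : ℝ≥0∞) ^ 2 * ENNReal.ofReal (E.meanVar (p i)) / (n i : ℝ≥0∞)
        + ENNReal.ofReal E.lam * (ENNReal.ofReal (E.virtualCost (c i)) * (n i : ℝ≥0∞))) := by
        refine Finset.sum_le_sum fun i _ => ?_
        rw [← mul_assoc (ENNReal.ofReal E.lam), ← ENNReal.ofReal_mul E.lam_pos.le]
        exact (mul_le_mul_right (iInf_le _ i) _).trans (mul_two_sqrt_le (w i)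
          (E.meanVar_pos (hp i)) (mul_pos E.lam_pos (E.virtualCost_pos (hc i))) (n i))
    _ = _ := by rw [Finset.sum_add_distrib]; rfl

variable {α : ℝ}

lemma Regular.mul_sqrt_le {ℓ L : ℝ} (h : E.Regular ℓ L) (hα : 0 ≤ α)
    (hσ : α * √(E.lam * E.virtualCost E.cmax) ≤ E.sigL) {p c : ℝ}
    (hp : p ∈ Set.Icc (0 : ℝ) 1) (hc : c ∈ Set.Icc E.cmin E.cmax) :
    α * √(E.lam * E.virtualCost c) ≤ √(E.meanVar p) := by
  refine (mul_le_mul_of_nonneg_left (Real.sqrt_le_sqrt ?_) hα).trans (hσ.trans ?_)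
  · exact mul_le_mul_of_nonneg_left (h.mono hc ⟨E.cmin_lt_cmax.le, le_rfl⟩ hc.2) E.lam_pos.le
  · exact Real.le_sqrt_of_sq_le (E.meanVar_mem hp).1

lemma Regular.one_le_quantity {ℓ L : ℝ} (h : E.Regular ℓ L) (hα : 1 < α)
    (hσ : α * √(E.lam * E.virtualCost E.cmax) ≤ E.sigL) {p c : ℝ}
    (hp : p ∈ Set.Icc (0 : ℝ) 1) (hc : c ∈ Set.Icc E.cmin E.cmax) : 1 ≤ E.quantity p c :=
  (floor_cost_le (E.meanVar_pos hp) (mul_pos E.lam_pos (E.virtualCost_pos hc.1)) hα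
    (h.mul_sqrt_le (by linarith) hσ hp hc)).1

lemma Regular.singleSourcing_cost_le [NeZero K] {ℓ L : ℝ} (h : E.Regular ℓ L) (hα : 1 < α)
    (hσ : α * √(E.lam * E.virtualCost E.cmax) ≤ E.sigL) {p c : Fin K → ℝ}
    (hp : ∀ i, p i ∈ Set.Icc (0 : ℝ) 1) (hc : ∀ i, c i ∈ Set.Icc E.cmin E.cmax)
    (s : Ranking K) :
    E.estimatorVar p ((E.singleSourcing p).purchase c s) ((E.singleSourcing p).weight c s)
      + ∑ i, ENNReal.ofReal E.lam * (ENNReal.ofReal (E.virtualCost (c i)) *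
          ((E.singleSourcing p).purchase c s i : ℝ≥0∞)) ≤
      ENNReal.ofReal (1 + 1 / (α - 1)) * E.costFloor p c := by
  classical
  obtain ⟨i, hi⟩ := E.exists_isSelected p c s
  have hother : ∀ j, j ≠ i → ¬E.IsSelected p c s j := fun j hj hs => hj (hs.eq hi)
  have hτ : 0 < E.lam * E.virtualCost (c i) := mul_pos E.lam_pos (E.virtualCost_pos (hc i).1)
  have hv := E.meanVar_pos (hp i)
  have hbound := floor_cost_le hv hτ hα (h.mul_sqrt_le (by linarith) hσ (hp i) (hc i))
  have hfloor : E.costFloor p c =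
      ENNReal.ofReal (2 * √(E.lam * E.virtualCost (c i) * E.meanVar (p i))) := by
    refine le_antisymm (iInf_le _ i) (le_iInf fun j => ENNReal.ofReal_le_ofReal ?_)
    refine mul_le_mul_of_nonneg_left (Real.sqrt_le_sqrt ?_) zero_le_two
    have := mul_le_mul_of_nonneg_left (hi.le j) E.lam_pos.le
    unfold costIndex at this
    linarith
  rw [estimatorVar, Finset.sum_eq_single i, Finset.sum_eq_single i]
  · have e1 : (E.singleSourcing p).weight c s i = 1 := by simp [singleSourcing, hi]
    have e2 : (E.singleSourcing p).purchase c s i =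
        ⌊√(E.meanVar (p i)) / √(E.lam * E.virtualCost (c i))⌋₊ := by
      simp [singleSourcing, sourcePurchase, hi]
    set n := ⌊√(E.meanVar (p i)) / √(E.lam * E.virtualCost (c i))⌋₊ with hn
    have hn0 : (0 : ℝ) < n := by exact_mod_cast hbound.1
    have hnn : (n : ℝ≥0∞) = ENNReal.ofReal (n : ℝ) := by simp
    rw [e1, e2, hfloor, ← ENNReal.ofReal_mul (by
      have : 0 < α - 1 := by linarith
      positivity), ← mul_assoc (ENNReal.ofReal E.lam),
      ← ENNReal.ofReal_mul E.lam_pos.le, hnn, ENNReal.coe_one, one_pow, one_mul,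
      ← ENNReal.ofReal_div_of_pos hn0, ← ENNReal.ofReal_mul hτ.le,
      ← ENNReal.ofReal_add (by positivity) (by positivity)]
    exact ENNReal.ofReal_le_ofReal hbound.2
  · intro j _ hj
    simp [singleSourcing, sourcePurchase, hother j hj]
  · simp
  · intro j _ hj
    simp [singleSourcing, hother j hj]
  · simp

section

variable {S : Type} [MeasurableSpace S] {ρ : Measure S} {A : Mechanism K S} {p : Fin K → ℝ}

/-- Since expected payments are nonnegative, the cost can be computed in `ℝ≥0∞`, where infinite
variance needs no separate treatment. -/
lemma buyerCost_eq (hpay : ∀ i, 0 ≤ ∫ x, A.pay x.1 x.2 i ∂E.costSeedLaw K ρ)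
    (hint : ∀ i, Integrable (fun x => A.pay x.1 x.2 i) (E.costSeedLaw K ρ)) :
    E.buyerCost ρ p A =
      ((∫⁻ x, E.estimatorVar p (A.purchase x.1 x.2) (A.weight x.1 x.2) ∂E.costSeedLaw K ρ
        + ENNReal.ofReal E.lam *
          ∑ i, ENNReal.ofReal (∫ x, A.pay x.1 x.2 i ∂E.costSeedLaw K ρ) : ℝ≥0∞) : EReal) := by
  rw [buyerCost, EReal.coe_ennreal_add, integral_finsetSum _ fun i _ => hint i,
    ← ENNReal.ofReal_sum_of_nonneg fun i _ => hpay i, ← ENNReal.ofReal_mul E.lam_pos.le,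
    EReal.coe_ennreal_ofReal, max_eq_left]
  exact mul_nonneg E.lam_pos.le (Finset.sum_nonneg fun i _ => hpay i)

lemma lintegral_cost (hA : ∀ i, Measurable fun x : (Fin K → ℝ) × S => A.purchase x.1 x.2 i) :
    ∫⁻ x, (E.estimatorVar p (A.purchase x.1 x.2) (A.weight x.1 x.2) +
        ∑ i, ENNReal.ofReal E.lam * (ENNReal.ofReal (E.virtualCost (x.1 i)) *
          (A.purchase x.1 x.2 i : ℝ≥0∞))) ∂E.costSeedLaw K ρ =
      ∫⁻ x, E.estimatorVar p (A.purchase x.1 x.2) (A.weight x.1 x.2) ∂E.costSeedLaw K ρ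
        + ENNReal.ofReal E.lam * ∑ i, ∫⁻ x, ENNReal.ofReal (E.virtualCost (x.1 i)) *
          (A.purchase x.1 x.2 i : ℝ≥0∞) ∂E.costSeedLaw K ρ := by
  have hc : Measurable fun n : ℕ => (n : ℝ≥0∞) := measurable_from_top
  have hm : ∀ i, Measurable fun x : (Fin K → ℝ) × S =>
      ENNReal.ofReal (E.virtualCost (x.1 i)) * (A.purchase x.1 x.2 i : ℝ≥0∞) := fun i =>
    Measurable.mul (by fun_prop) (hc.comp (hA i))
  rw [lintegral_add_right _ (Finset.measurable_sum _ fun i _ => (hm i).const_mul _),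
    lintegral_finsetSum _ fun i _ => (hm i).const_mul _, Finset.mul_sum]
  simp only [lintegral_const_mul _ (hm _)]

variable [IsProbabilityMeasure ρ]

lemma lintegral_costFloor :
    ∫⁻ x, E.costFloor p x.1 ∂E.costSeedLaw K ρ =
      ∫⁻ c, E.costFloor p c ∂Measure.pi fun _ : Fin K => E.costLaw :=
  measurePreserving_fst.lintegral_comp (measurable_costFloor p)

lemma Regular.le_buyerCost {ℓ L : ℝ} (h : E.Regular ℓ L)
    (hp : ∀ i, p i ∈ Set.Icc (0 : ℝ) 1) (hA : E.IsFeasible ρ A) :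
    ((∫⁻ c, E.costFloor p c ∂Measure.pi fun _ : Fin K => E.costLaw : ℝ≥0∞) : EReal)
      ≤ E.buyerCost ρ p A := by
  rw [buyerCost_eq (fun i => (h.le_expected_pay hA i).1) hA.integrable_pay,
    EReal.coe_ennreal_le_coe_ennreal_iff, ← lintegral_costFloor (ρ := ρ)]
  calc ∫⁻ x, E.costFloor p x.1 ∂E.costSeedLaw K ρ
      ≤ _ := lintegral_mono_ae (by
        filter_upwards [E.ae_costSeedLaw ρ] with x hx
        exact costFloor_le hp (fun i => (hx i).1) (A.purchase x.1 x.2) (A.weight x.1 x.2)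
          (hA.weight_sum x.1 x.2))
    _ = _ := lintegral_cost hA.measurable_purchase
    _ ≤ _ := by
      gcongr with i
      exact (h.le_expected_pay hA i).2

end

/-- Single-sourcing is approximately optimal at every belief profile. -/
theorem Regular.isApproxSolution_singleSourcing [NeZero K] {ℓ L : ℝ} (h : E.Regular ℓ L)
    (hα : 1 < α) (hσ : α * √(E.lam * E.virtualCost E.cmax) ≤ E.sigL) {p : Fin K → ℝ}
    (hp : ∀ i, p i ∈ Set.Icc (0 : ℝ) 1) :
    E.IsApproxSolution (rankingLaw K) (1 / (α - 1)) p (E.singleSourcing p) := by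
  have hfeas := isFeasible_singleSourcing h hp
  refine ⟨hfeas, fun S' _ ρ' _ B hB => ?_⟩
  have hz : 0 ≤ 1 + 1 / (α - 1) := by
    have : 0 < α - 1 := by linarith
    positivity
  have hup : E.buyerCost (rankingLaw K) p (E.singleSourcing p) ≤
      ((ENNReal.ofReal (1 + 1 / (α - 1)) *
        ∫⁻ c, E.costFloor p c ∂Measure.pi fun _ : Fin K => E.costLaw : ℝ≥0∞) : EReal) := by
    rw [buyerCost_eq (fun i => (h.le_expected_pay hfeas i).1) hfeas.integrable_pay,
      EReal.coe_ennreal_le_coe_ennreal_iff]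
    simp only [h.expected_pay_singleSourcing hp]
    have hm : Measurable fun x : (Fin K → ℝ) × Ranking K => E.costFloor p x.1 :=
      (measurable_costFloor p).comp measurable_fst
    rw [← lintegral_cost hfeas.measurable_purchase, ← lintegral_costFloor (ρ := rankingLaw K),
      ← lintegral_const_mul _ hm]
    refine lintegral_mono_ae ?_
    filter_upwards [E.ae_costSeedLaw (rankingLaw K)] with x hx
    exact h.singleSourcing_cost_le hα hσ hp hx x.2
  refine hup.trans ?_
  rw [EReal.coe_ennreal_mul, EReal.coe_ennreal_ofReal, max_eq_left hz]
  exact mul_le_mul_of_nonneg_left (h.le_buyerCost hp hB) (by exact_mod_cast hz)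

end Market

/-! ### Products of densities -/

lemma lintegral_fin_prod_eq_prod {n : ℕ} {μ : Fin n → Measure ℝ} [∀ i, SigmaFinite (μ i)]
    {f : Fin n → ℝ → ℝ≥0∞} (hf : ∀ i, Measurable (f i)) :
    ∫⁻ x, ∏ i, f i (x i) ∂Measure.pi μ = ∏ i, ∫⁻ x, f i x ∂μ i := by
  induction n with
  | zero => simp
  | succ n ih =>
    have hmp := (measurePreserving_piFinSuccAbove μ 0).symm
    have hg : Measurable fun x : Fin n → ℝ => ∏ i, f (Fin.succ i) (x i) :=
      Finset.measurable_prod _ fun i _ => (hf _).comp (measurable_pi_apply i)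
    have hF : Measurable fun x : Fin (n + 1) → ℝ => ∏ i, f i (x i) :=
      Finset.measurable_prod _ fun i _ => (hf _).comp (measurable_pi_apply i)
    rw [← hmp.lintegral_comp hF, Fin.prod_univ_succ, ← ih fun i => hf _,
      ← lintegral_prod_mul (hf 0).aemeasurable hg.aemeasurable]
    refine lintegral_congr fun x => ?_
    simp [MeasurableEquiv.piFinSuccAbove_symm_apply, Fin.insertNthEquiv, Fin.prod_univ_succ]

lemma pi_withDensity {n : ℕ} {μ : Measure ℝ} [SigmaFinite μ] {f : ℝ → ℝ≥0∞} (hf : Measurable f)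
    [SigmaFinite (μ.withDensity f)] :
    Measure.pi (fun _ : Fin n => μ.withDensity f) =
      (Measure.pi fun _ : Fin n => μ).withDensity fun x => ∏ i, f (x i) := by
  refine Measure.pi_eq fun s hs => ?_
  rw [withDensity_apply _ (MeasurableSet.univ_pi hs),
    ← lintegral_indicator (MeasurableSet.univ_pi hs)]
  calc ∫⁻ x, (Set.univ.pi s).indicator (fun x => ∏ i, f (x i)) x ∂Measure.pi (fun _ => μ)
      = ∫⁻ x, ∏ i, (s i).indicator f (x i) ∂Measure.pi (fun _ => μ) := by
        refine lintegral_congr fun x => ?_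
        by_cases hx : x ∈ Set.univ.pi s
        · rw [Set.indicator_of_mem hx]
          exact Finset.prod_congr rfl fun i _ => (Set.indicator_of_mem (hx i trivial) f).symm
        · rw [Set.indicator_of_notMem hx]
          simp only [Set.mem_pi, Set.mem_univ, true_implies, not_forall] at hx
          obtain ⟨i, hi⟩ := hx
          exact (Finset.prod_eq_zero (Finset.mem_univ i) (Set.indicator_of_notMem hi f)).symm
    _ = ∏ i, ∫⁻ x, (s i).indicator f x ∂μ :=
        lintegral_fin_prod_eq_prod fun i => hf.indicator (hs i)
    _ = _ := Finset.prod_congr rfl fun i _ => by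
        rw [lintegral_indicator (hs i), withDensity_apply _ (hs i)]

/-! ### The law of the sample variance -/

lemma measurable_sampleVar {m : ℕ} : Measurable (sampleVar : (Fin m → ℝ) → ℝ) := by
  unfold sampleVar; fun_prop

lemma sampleVar_nonneg {m : ℕ} (x : Fin m → ℝ) : 0 ≤ sampleVar x := by
  rcases Nat.eq_zero_or_pos m with rfl | hm
  · simp [sampleVar]
  · have : (1 : ℝ) ≤ m := by exact_mod_cast hm
    exact div_nonneg (Finset.sum_nonneg fun _ _ => sq_nonneg _) (by linarith)

lemma sampleVar_add_const {k : ℕ} (x : Fin (k + 1) → ℝ) (t : ℝ) :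
    sampleVar (fun j => x j + t) = sampleVar x := by
  have hk : ((k : ℝ) + 1) ≠ 0 := by positivity
  unfold sampleVar
  congr 1
  refine Finset.sum_congr rfl fun j _ => ?_
  rw [Finset.sum_add_distrib]
  simp only [Finset.sum_const, Finset.card_univ, Fintype.card_fin, nsmul_eq_mul]
  push_cast
  field_simp
  ring

lemma sampleVar_smul {m : ℕ} (r : ℝ) (x : Fin m → ℝ) :
    sampleVar (fun j => r * x j) = r ^ 2 * sampleVar x := by
  unfold sampleVar
  rw [← mul_div_assoc, Finset.mul_sum]
  congr 1
  refine Finset.sum_congr rfl fun j _ => ?_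
  rw [← Finset.mul_sum]
  ring

/-- Decomposition of squares around `θ` into spread and displacement of the sample mean. With `k +
1` observations the sample variance has `k` degrees of freedom. -/
lemma sum_sub_sq_eq {k : ℕ} (hk : 1 ≤ k) (x : Fin (k + 1) → ℝ) (θ : ℝ) :
    ∑ j, (x j - θ) ^ 2 = k * sampleVar x
      + ((k : ℝ) + 1) * ((∑ j, x j) / ((k : ℝ) + 1) - θ) ^ 2 := by
  have hk0 : (k : ℝ) ≠ 0 := by positivity
  have hk1 : ((k : ℝ) + 1) ≠ 0 := by positivity
  unfold sampleVar
  push_cast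
  rw [add_sub_cancel_right, mul_div_cancel₀ _ hk0]
  set M := (∑ j, x j) / ((k : ℝ) + 1) with hM
  have hS : ∑ j, x j = ((k : ℝ) + 1) * M := by rw [hM]; field_simp
  have e : ∀ j, (x j - θ) ^ 2 = (x j - M) ^ 2 + 2 * (M - θ) * x j + (θ ^ 2 - M ^ 2) := by
    intro j; ring
  simp only [e, Finset.sum_add_distrib, ← Finset.mul_sum, hS]
  simp only [Finset.sum_const, Finset.card_univ, Fintype.card_fin, nsmul_eq_mul]
  push_cast
  ring

/-- The sample variance of `0, y₁, …, yₖ`. -/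
def anchoredVar {k : ℕ} (y : Fin k → ℝ) : ℝ := sampleVar (Fin.cons 0 y : Fin (k + 1) → ℝ)

lemma measurable_cons {k : ℕ} :
    Measurable fun y : ℝ × (Fin k → ℝ) => (Fin.cons y.1 y.2 : Fin (k + 1) → ℝ) := by
  refine measurable_pi_lambda _ fun j => ?_
  refine Fin.cases ?_ (fun j => ?_) j
  · simpa using measurable_fst
  · simp only [Fin.cons_succ]; fun_prop

lemma measurable_anchoredVar {k : ℕ} : Measurable (anchoredVar : (Fin k → ℝ) → ℝ) :=
  measurable_sampleVar.comp (measurable_cons.comp (measurable_const.prodMk measurable_id))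

lemma anchoredVar_smul {k : ℕ} (r : ℝ) (y : Fin k → ℝ) :
    anchoredVar (r • y) = r ^ 2 * anchoredVar y := by
  unfold anchoredVar
  rw [← sampleVar_smul]
  congr 1
  funext j
  refine Fin.cases ?_ (fun j => ?_) j <;> simp

lemma anchoredVar_eq_zero {k : ℕ} (hk : 1 ≤ k) {y : Fin k → ℝ} (h : anchoredVar y = 0) :
    y = 0 := by
  have hk0 : (k : ℝ) ≠ 0 := by positivity
  unfold anchoredVar sampleVar at h
  push_cast at h
  rw [add_sub_cancel_right, div_eq_zero_iff, or_iff_left hk0,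
    Finset.sum_eq_zero_iff_of_nonneg fun _ _ => sq_nonneg _] at h
  have h0 := h 0 (Finset.mem_univ _)
  funext j
  have hj := h j.succ (Finset.mem_univ _)
  rw [pow_eq_zero_iff two_ne_zero] at h0 hj
  rw [Fin.cons_zero] at h0
  rw [Fin.cons_succ] at hj
  simp only [Pi.zero_apply]
  linarith

/-- Integrating out the sample mean. -/
lemma lintegral_sampleVar_mul_gaussianPDF {k : ℕ} {G : ℝ → ℝ≥0∞} (hG : Measurable G) (θ : ℝ)
    {w : ℝ≥0} (hw : w ≠ 0) :
    ∫⁻ x : Fin (k + 1) → ℝ, G (sampleVar x) * gaussianPDF θ w ((∑ j, x j) / ((k : ℝ) + 1)) =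
      ∫⁻ y : Fin k → ℝ, G (anchoredVar y) := by
  have hk1 : ((k : ℝ) + 1) ≠ 0 := by positivity
  have hpdf := measurable_gaussianPDF θ w
  have hF : Measurable fun x : Fin (k + 1) → ℝ =>
      G (sampleVar x) * gaussianPDF θ w ((∑ j, x j) / ((k : ℝ) + 1)) :=
    (hG.comp measurable_sampleVar).mul (hpdf.comp (by fun_prop))
  have hmp := (volume_preserving_piFinSuccAbove (fun _ : Fin (k + 1) => ℝ) 0).symm
  have hcons : ∀ y : ℝ × (Fin k → ℝ),
      (MeasurableEquiv.piFinSuccAbove (fun _ : Fin (k + 1) => ℝ) 0).symm y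
        = (Fin.cons y.1 y.2 : Fin (k + 1) → ℝ) := by
    intro y
    simp [MeasurableEquiv.piFinSuccAbove_symm_apply, Fin.insertNthEquiv]
  have hshift : ∀ (t : ℝ) (y : Fin k → ℝ), (Fin.cons t (y + fun _ => t) : Fin (k + 1) → ℝ)
      = fun j => (Fin.cons 0 y : Fin (k + 1) → ℝ) j + t := by
    intro t y
    funext j
    refine Fin.cases ?_ (fun j => ?_) j <;> simp
  rw [← hmp.lintegral_comp hF]
  simp only [hcons]
  rw [Measure.volume_eq_prod]
  refine (lintegral_prod _ (hF.comp measurable_cons).aemeasurable).trans ?_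
  have hF2 : Measurable fun z : ℝ × (Fin k → ℝ) => G (anchoredVar z.2) *
      gaussianPDF θ w (z.1 + (∑ j, (Fin.cons 0 z.2 : Fin (k + 1) → ℝ) j) / ((k : ℝ) + 1)) := by
    have hc : Measurable fun z : ℝ × (Fin k → ℝ) => (Fin.cons 0 z.2 : Fin (k + 1) → ℝ) :=
      measurable_cons.comp (measurable_const.prodMk measurable_snd)
    have hs : Measurable fun z : ℝ × (Fin k → ℝ) =>
        ∑ j, (Fin.cons 0 z.2 : Fin (k + 1) → ℝ) j :=
      Finset.measurable_sum _ fun j _ => (measurable_pi_apply j).comp hc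
    exact (hG.comp (measurable_anchoredVar.comp measurable_snd)).mul
      (hpdf.comp (measurable_fst.add (hs.div_const _)))
  -- The remaining coordinates are translated by the first one, `t`. The sample variance no longer
  -- sees `t`, and the mean is `t` plus a function of `y`, so integrating the Gaussian density over
  -- `t` gives one.
  calc _ = ∫⁻ t : ℝ, ∫⁻ y : Fin k → ℝ, G (anchoredVar y) *
        gaussianPDF θ w (t + (∑ j, (Fin.cons 0 y : Fin (k + 1) → ℝ) j) / ((k : ℝ) + 1)) := by
        refine lintegral_congr fun t => ?_
        rw [← lintegral_add_right_eq_self _ (fun _ : Fin k => t)]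
        refine lintegral_congr fun y => ?_
        simp only [Function.comp_apply]
        rw [hshift, sampleVar_add_const, Finset.sum_add_distrib]
        simp only [Finset.sum_const, Finset.card_univ, Fintype.card_fin, nsmul_eq_mul]
        congr 2
        push_cast
        field_simp
        ring
    _ = ∫⁻ y : Fin k → ℝ, ∫⁻ t : ℝ, G (anchoredVar y) *
        gaussianPDF θ w (t + (∑ j, (Fin.cons 0 y : Fin (k + 1) → ℝ) j) / ((k : ℝ) + 1)) :=
        lintegral_lintegral_swap hF2.aemeasurable
    _ = _ := by
        refine lintegral_congr fun y => ?_
        have hm : Measurable fun t : ℝ => gaussianPDF θ w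
            (t + (∑ j, (Fin.cons 0 y : Fin (k + 1) → ℝ) j) / ((k : ℝ) + 1)) :=
          hpdf.comp (by fun_prop)
        rw [lintegral_const_mul _ hm,
          lintegral_add_right_eq_self (fun t => gaussianPDF θ w t),
          lintegral_gaussianPDF_eq_one θ hw, mul_one]

/-- The density of the sample variance with respect to `volume.map anchoredVar`. -/
def varDensity (σ : ℝ) (k : ℕ) (s : ℝ) : ℝ :=
  (σ * √(2 * Real.pi))⁻¹ ^ k * (√((k : ℝ) + 1))⁻¹ * Real.exp (-(k * s) / (2 * σ ^ 2))

/-- By `sum_sub_sq_eq` the exponent splits; the factor `√(k + 1)` moved between the two parts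
normalises the density of the mean, whose variance is `σ² / (k + 1)`. -/
lemma prod_gaussianPDF {k : ℕ} (hk : 1 ≤ k) (θ : ℝ) {σ : ℝ} (hσ : 0 < σ)
    (x : Fin (k + 1) → ℝ) :
    ∏ j, gaussianPDF θ (Real.toNNReal (σ ^ 2)) (x j) =
      ENNReal.ofReal (varDensity σ k (sampleVar x)) *
        gaussianPDF θ (Real.toNNReal (σ ^ 2 / ((k : ℝ) + 1)))
          ((∑ j, x j) / ((k : ℝ) + 1)) := by
  have hk1 : (0 : ℝ) < (k : ℝ) + 1 := by positivity
  simp only [gaussianPDF]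
  rw [← ENNReal.ofReal_prod_of_nonneg fun j _ => gaussianPDFReal_nonneg _ _ _,
    ← ENNReal.ofReal_mul (by unfold varDensity; positivity)]
  congr 1
  simp only [gaussianPDFReal_def, Real.coe_toNNReal _ (sq_nonneg σ),
    Real.coe_toNNReal (σ ^ 2 / ((k : ℝ) + 1)) (by positivity), Finset.prod_mul_distrib,
    ← Real.exp_sum, varDensity]
  rw [← Finset.sum_div, Finset.sum_neg_distrib, sum_sub_sq_eq hk x θ, Finset.prod_const,
    Finset.card_univ, Fintype.card_fin]
  set D := (∑ j, x j) / ((k : ℝ) + 1) - θ with hD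
  have h2 : √(2 * Real.pi * σ ^ 2) = σ * √(2 * Real.pi) := by
    rw [Real.sqrt_mul (by positivity), Real.sqrt_sq hσ.le, mul_comm]
  have h3 : √(2 * Real.pi * (σ ^ 2 / ((k : ℝ) + 1))) = σ * √(2 * Real.pi) / √((k : ℝ) + 1) := by
    rw [← mul_div_assoc, Real.sqrt_div (by positivity), h2]
  rw [h2, h3]
  have he : -(k * sampleVar x + ((k : ℝ) + 1) * D ^ 2) / (2 * σ ^ 2)
      = -(k * sampleVar x) / (2 * σ ^ 2) + -D ^ 2 / (2 * (σ ^ 2 / ((k : ℝ) + 1))) := by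
    field_simp; ring
  rw [he, Real.exp_add, pow_succ]
  have hs : √((k : ℝ) + 1) ≠ 0 := (Real.sqrt_pos.2 hk1).ne'
  have hp : √(2 * Real.pi) ≠ 0 := by positivity
  field_simp

namespace Market

instance isProbabilityMeasure_normalSamples (θ σ : ℝ) (m : ℕ) :
    IsProbabilityMeasure (normalSamples θ σ m) := by unfold normalSamples; infer_instance

/-- The reference measure does not depend on `σ`, so the likelihood ratio can be read off from
`varDensity` without the explicit chi-square density. -/
lemma map_sampleVar {k : ℕ} (hk : 1 ≤ k) (θ : ℝ) {σ : ℝ} (hσ : 0 < σ) :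
    (normalSamples θ σ (k + 1)).map sampleVar =
      ((volume : Measure (Fin k → ℝ)).map anchoredVar).withDensity
        fun s => ENNReal.ofReal (varDensity σ k s) := by
  have hv : Real.toNNReal (σ ^ 2) ≠ 0 := by simp [hσ.ne']
  have hw : Real.toNNReal (σ ^ 2 / ((k : ℝ) + 1)) ≠ 0 := by
    rw [ne_eq, Real.toNNReal_eq_zero, not_le]; positivity
  have hd : Measurable fun s => ENNReal.ofReal (varDensity σ k s) := by
    unfold varDensity; fun_prop
  have hlaw : normalSamples θ σ (k + 1) = (volume : Measure (Fin (k + 1) → ℝ)).withDensity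
      fun x => ∏ j, gaussianPDF θ (Real.toNNReal (σ ^ 2)) (x j) := by
    have h1 := gaussianReal_of_var_ne_zero θ hv
    have : SigmaFinite ((volume : Measure ℝ).withDensity
        (gaussianPDF θ (Real.toNNReal (σ ^ 2)))) := by rw [← h1]; infer_instance
    rw [normalSamples, h1, pi_withDensity (measurable_gaussianPDF _ _), volume_pi]
  ext A hA
  rw [Measure.map_apply measurable_sampleVar hA, hlaw,
    withDensity_apply _ (measurable_sampleVar hA), withDensity_apply _ hA,
    ← lintegral_indicator hA, ← lintegral_indicator (measurable_sampleVar hA),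
    lintegral_map (hd.indicator hA) measurable_anchoredVar,
    ← lintegral_sampleVar_mul_gaussianPDF (hd.indicator hA) θ hw]
  refine lintegral_congr fun x => ?_
  by_cases hx : sampleVar x ∈ A
  · rw [Set.indicator_of_mem (show x ∈ sampleVar ⁻¹' A from hx), Set.indicator_of_mem hx,
      prod_gaussianPDF hk θ hσ]
  · rw [Set.indicator_of_notMem (show x ∉ sampleVar ⁻¹' A from hx), Set.indicator_of_notMem hx,
      zero_mul]

end Market

/-- By homogeneity of degree two, the volume of `{y | r * anchoredVar y ∈ A}` is, for each `r > 0`,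
a positive multiple of the volume of the preimage of `A`. By Fubini its integral over `r > 0`
vanishes: for fixed `y ≠ 0` the set of such `r` is a rescaling of the null set `A`. -/
lemma map_anchoredVar_absolutelyContinuous {k : ℕ} (hk : 1 ≤ k) :
    (volume : Measure (Fin k → ℝ)).map anchoredVar ≪ volume := by
  have : Nonempty (Fin k) := ⟨⟨0, hk⟩⟩
  refine Measure.AbsolutelyContinuous.mk fun A hA hA0 => ?_
  rw [Measure.map_apply measurable_anchoredVar hA]
  have hS : MeasurableSet {z : ℝ × (Fin k → ℝ) | z.1 * anchoredVar z.2 ∈ A} :=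
    (measurable_fst.mul (measurable_anchoredVar.comp measurable_snd)) hA
  have hswap : ∫⁻ r in Set.Ioi (0 : ℝ), (volume : Measure (Fin k → ℝ))
      {y | r * anchoredVar y ∈ A} = 0 := by
    have e1 : ∀ r : ℝ, (volume : Measure (Fin k → ℝ)) {y | r * anchoredVar y ∈ A} =
        ∫⁻ y : Fin k → ℝ,
          {z : ℝ × (Fin k → ℝ) | z.1 * anchoredVar z.2 ∈ A}.indicator 1 (r, y) := by
      intro r
      exact (lintegral_indicator_one (measurable_anchoredVar.const_mul r hA)).symm
    simp only [e1]
    rw [lintegral_lintegral_swap (f := fun r y =>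
      {z : ℝ × (Fin k → ℝ) | z.1 * anchoredVar z.2 ∈ A}.indicator 1 (r, y))
      (measurable_one.indicator hS).aemeasurable]
    have hne : ∀ᵐ y : Fin k → ℝ, y ≠ 0 := by
      rw [ae_iff]; simp
    rw [lintegral_congr_ae (g := fun _ => 0), lintegral_zero]
    filter_upwards [hne] with y hy
    have hq : anchoredVar y ≠ 0 := fun h => hy (anchoredVar_eq_zero hk h)
    have e2 : ∫⁻ r in Set.Ioi (0 : ℝ),
        {z : ℝ × (Fin k → ℝ) | z.1 * anchoredVar z.2 ∈ A}.indicator (1 : ℝ × (Fin k → ℝ) → ℝ≥0∞) (r, y)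
        = (volume.restrict (Set.Ioi (0 : ℝ))) ((fun r => r * anchoredVar y) ⁻¹' A) := by
      exact lintegral_indicator_one (measurable_id.mul_const (anchoredVar y) hA)
    rw [e2]
    refine Measure.restrict_le_self.absolutelyContinuous ?_
    rw [Real.volume_preimage_mul_right hq, hA0, mul_zero]
  have hscale : ∀ r : ℝ, 0 < r → (volume : Measure (Fin k → ℝ)) {y | r * anchoredVar y ∈ A} =
      ENNReal.ofReal |((√r) ^ Module.finrank ℝ (Fin k → ℝ))⁻¹| *
        (volume : Measure (Fin k → ℝ)) (anchoredVar ⁻¹' A) := by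
    intro r hr
    rw [← Measure.addHaar_preimage_smul volume (Real.sqrt_pos.2 hr).ne']
    congr 1
    ext y
    simp [anchoredVar_smul, Real.sq_sqrt hr.le]
  by_contra hne
  have hmeas : Measurable fun r : ℝ =>
      (volume : Measure (Fin k → ℝ)) {y | r * anchoredVar y ∈ A} :=
    measurable_measure_prodMk_left hS
  rw [lintegral_eq_zero_iff hmeas, Filter.EventuallyEq, ae_restrict_iff' measurableSet_Ioi] at hswap
  have hfalse : ∀ᵐ r : ℝ, r ∉ Set.Ioi (0 : ℝ) := by
    filter_upwards [hswap] with r hr h0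
    have h1 := hr h0
    rw [hscale r h0] at h1
    have h2 : (√r) ^ Module.finrank ℝ (Fin k → ℝ) ≠ 0 :=
      pow_ne_zero _ (Real.sqrt_pos.2 h0).ne'
    exact mul_ne_zero (ENNReal.ofReal_pos.2 (abs_pos.2 (inv_ne_zero h2))).ne' hne h1
  have := measure_eq_zero_iff_ae_notMem.2 hfalse
  simp at this

namespace Market

variable (E : Market)

/-! ### Posterior beliefs -/

/-- The likelihood ratio of the high to the low variance at sample variance `s` with `k` degrees
of freedom. -/
def likelihoodRatio (k : ℕ) (s : ℝ) : ℝ :=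
  (E.sigL / E.sigH) ^ k * Real.exp (k * s / (2 * E.sigL ^ 2) - k * s / (2 * E.sigH ^ 2))

/-- The posterior probability of the high variance. -/
def posterior (k : ℕ) (s : ℝ) : ℝ :=
  (1 - E.mu) * E.likelihoodRatio k s / (E.mu + (1 - E.mu) * E.likelihoodRatio k s)

lemma sigH_pos : 0 < E.sigH := E.sigL_pos.trans E.sigL_lt_sigH

lemma likelihoodRatio_pos (k : ℕ) (s : ℝ) : 0 < E.likelihoodRatio k s := by
  have := E.sigL_pos
  have := E.sigH_pos
  unfold likelihoodRatio; positivity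

lemma varDensity_sigH (k : ℕ) (s : ℝ) :
    varDensity E.sigH k s = varDensity E.sigL k s * E.likelihoodRatio k s := by
  have h1 := E.sigL_pos.ne'
  have h2 := E.sigH_pos.ne'
  have hp : √(2 * Real.pi) ≠ 0 := by positivity
  unfold varDensity likelihoodRatio
  rw [mul_mul_mul_comm, ← Real.exp_add, mul_right_comm _ _ ((E.sigL / E.sigH) ^ k), ← mul_pow]
  congr 2
  · congr 2
    field_simp
  · ring

/-- The likelihoods are Radon-Nikodym derivatives, determined only almost everywhere, so Bayes' rule
is available only almost surely. The chain rule for the law `PH`, which has density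
`likelihoodRatio` with respect to `PL`, gives the ratio, and `PH ≪ PL` transfers the statement to
high-variance samples. -/
lemma ae_likelihood {k : ℕ} (hk : 1 ≤ k) (θ : ℝ) {σ : ℝ} (hσ : σ = E.sigL ∨ σ = E.sigH) :
    ∀ᵐ x ∂normalSamples θ σ (k + 1),
      0 < likelihood θ E.sigL (k + 1) (sampleVar x) ∧
      likelihood θ E.sigH (k + 1) (sampleVar x) =
        E.likelihoodRatio k (sampleVar x) * likelihood θ E.sigL (k + 1) (sampleVar x) := by
  set PL := (normalSamples θ E.sigL (k + 1)).map sampleVar with hPL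
  set PH := (normalSamples θ E.sigH (k + 1)).map sampleVar with hPH
  have hd : ∀ σ, Measurable fun s => ENNReal.ofReal (varDensity σ k s) := fun σ => by
    unfold varDensity; fun_prop
  have hr : Measurable fun s => ENNReal.ofReal (E.likelihoodRatio k s) := by
    unfold likelihoodRatio; fun_prop
  have hH : PH = PL.withDensity fun s => ENNReal.ofReal (E.likelihoodRatio k s) := by
    rw [hPH, hPL, map_sampleVar hk θ E.sigH_pos, map_sampleVar hk θ E.sigL_pos,
      ← withDensity_mul _ (hd _) hr]
    congr 1
    funext s
    rw [varDensity_sigH, ENNReal.ofReal_mul]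
    · rfl
    · have := E.sigL_pos
      unfold varDensity; positivity
  have hprobL : IsProbabilityMeasure PL :=
    Measure.isProbabilityMeasure_map measurable_sampleVar.aemeasurable
  have hLac : PL ≪ volume := by
    rw [hPL, map_sampleVar hk θ E.sigL_pos]
    exact (withDensity_absolutelyContinuous _ _).trans (map_anchoredVar_absolutelyContinuous hk)
  have hHac : PH ≪ PL := by rw [hH]; exact withDensity_absolutelyContinuous _ _
  have hL : ∀ᵐ s ∂PL, 0 < likelihood θ E.sigL (k + 1) s ∧
      likelihood θ E.sigH (k + 1) s =
        E.likelihoodRatio k s * likelihood θ E.sigL (k + 1) s := by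
    have h1 := Measure.rnDeriv_withDensity_left_of_absolutelyContinuous hLac hr.aemeasurable
    filter_upwards [Measure.rnDeriv_pos hLac, hLac (Measure.rnDeriv_lt_top PL volume),
      hLac h1] with s hs1 hs2 hs3
    refine ⟨ENNReal.toReal_pos hs1.ne' hs2.ne, ?_⟩
    unfold likelihood
    rw [← hPH, ← hPL, hH, hs3, ENNReal.toReal_mul,
      ENNReal.toReal_ofReal (E.likelihoodRatio_pos k s).le]
  rcases hσ with rfl | rfl
  · exact ae_of_ae_map measurable_sampleVar.aemeasurable hL
  · exact ae_of_ae_map measurable_sampleVar.aemeasurable (hHac hL)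

instance isProbabilityMeasure_freeSampleLaw (θ : ℝ) (m : ℕ) :
    IsProbabilityMeasure (E.freeSampleLaw θ m) := by
  refine ⟨?_⟩
  have h1 := E.mu_pos
  have h2 := E.mu_lt_one
  simp only [freeSampleLaw, Measure.add_apply, Measure.smul_apply, measure_univ, smul_eq_mul,
    mul_one]
  rw [← ENNReal.ofReal_add h1.le (by linarith)]
  simp

lemma ae_belief (θ : ℝ) (m : ℕ) :
    ∀ᵐ x ∂E.freeSampleLaw θ m, E.belief θ x = E.posterior (m - 1) (sampleVar x) := by
  -- Without a sample variance the truncated subtraction gives `m - 1 = 0`, and zero degrees of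
  -- freedom have likelihood ratio one, so `posterior` is the prior.
  by_cases hm : m < 2
  · refine ae_of_all _ fun x => ?_
    have : m - 1 = 0 := by omega
    simp [belief, hm, this, posterior, likelihoodRatio]
  · obtain ⟨k, rfl⟩ : ∃ k, m = k + 1 := ⟨m - 1, by omega⟩
    have hk : 1 ≤ k := by omega
    have key : ∀ {σ : ℝ}, σ = E.sigL ∨ σ = E.sigH → ∀ᵐ x ∂normalSamples θ σ (k + 1),
        E.belief θ x = E.posterior (k + 1 - 1) (sampleVar x) := by
      intro σ hσ
      filter_upwards [E.ae_likelihood hk θ hσ] with x hx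
      rw [belief, if_neg hm, hx.2, posterior, Nat.add_sub_cancel]
      rw [← mul_div_mul_right ((1 - E.mu) * E.likelihoodRatio k (sampleVar x)) _ hx.1.ne']
      congr 1 <;> ring
    rw [freeSampleLaw, ae_add_measure_iff]
    exact ⟨Measure.ae_smul_measure (key (Or.inl rfl)) _,
      Measure.ae_smul_measure (key (Or.inr rfl)) _⟩

lemma measurable_belief (θ : ℝ) (m : ℕ) :
    Measurable fun x : Fin m → ℝ => E.belief θ x := by
  have h : ∀ σ, Measurable fun x : Fin m → ℝ => likelihood θ σ m (sampleVar x) := fun σ =>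
    ((Measure.measurable_rnDeriv _ _).ennreal_toReal).comp measurable_sampleVar
  have h1 := h E.sigL
  have h2 := h E.sigH
  unfold belief
  split_ifs
  · exact measurable_const
  · fun_prop

lemma belief_mem (θ : ℝ) {m : ℕ} (x : Fin m → ℝ) : E.belief θ x ∈ Set.Icc (0 : ℝ) 1 := by
  have h1 := E.mu_pos
  have h2 : 0 < 1 - E.mu := by linarith [E.mu_lt_one]
  unfold belief
  split_ifs
  · exact ⟨h2.le, by linarith⟩
  · have a : 0 ≤ likelihood θ E.sigL m (sampleVar x) := ENNReal.toReal_nonneg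
    have b : 0 ≤ likelihood θ E.sigH m (sampleVar x) := ENNReal.toReal_nonneg
    refine ⟨by positivity, div_le_one_of_le₀ ?_ (by positivity)⟩
    have : 0 ≤ E.mu * likelihood θ E.sigL m (sampleVar x) := by positivity
    linarith

/-- The rate at which the log likelihood ratio grows in the sample variance. -/
def ratioSlope (k : ℕ) : ℝ := k / (2 * E.sigL ^ 2) - k / (2 * E.sigH ^ 2)

lemma ratioSlope_nonneg (k : ℕ) : 0 ≤ E.ratioSlope k := by
  have h := E.sigL_sq_lt
  have := E.sigL_pos
  unfold ratioSlope
  rw [sub_nonneg]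
  gcongr

lemma likelihoodRatio_eq (k : ℕ) (s : ℝ) :
    E.likelihoodRatio k s = (E.sigL / E.sigH) ^ k * Real.exp (E.ratioSlope k * s) := by
  unfold likelihoodRatio ratioSlope
  congr 2
  ring

lemma posterior_mono {k l : ℕ} {s t : ℝ} (h : E.likelihoodRatio k s ≤ E.likelihoodRatio l t) :
    E.posterior k s ≤ E.posterior l t := by
  have h1 := E.mu_pos
  have h2 : 0 < 1 - E.mu := by linarith [E.mu_lt_one]
  have h3 := E.likelihoodRatio_pos k s
  have h4 := E.likelihoodRatio_pos l t
  unfold posterior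
  rw [div_le_div_iff₀ (by positivity) (by positivity)]
  nlinarith [mul_le_mul_of_nonneg_left h (mul_pos h1 h2).le]

lemma posterior_strictMono {k l : ℕ} {s t : ℝ}
    (h : E.likelihoodRatio k s < E.likelihoodRatio l t) : E.posterior k s < E.posterior l t := by
  have h1 := E.mu_pos
  have h2 : 0 < 1 - E.mu := by linarith [E.mu_lt_one]
  have h3 := E.likelihoodRatio_pos k s
  have h4 := E.likelihoodRatio_pos l t
  unfold posterior
  rw [div_lt_div_iff₀ (by positivity) (by positivity)]
  nlinarith [mul_lt_mul_of_pos_left h (mul_pos h1 h2)]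

lemma posterior_zero_le (k : ℕ) {s : ℝ} (hs : 0 ≤ s) : E.posterior k 0 ≤ E.posterior k s := by
  refine E.posterior_mono ?_
  have h1 := E.sigL_pos
  have h2 := E.sigH_pos
  rw [likelihoodRatio_eq, likelihoodRatio_eq]
  gcongr
  exact E.ratioSlope_nonneg k

lemma ratio_lt_one : E.sigL / E.sigH < 1 := (div_lt_one E.sigH_pos).2 E.sigL_lt_sigH

lemma posterior_zero_antitone {k l : ℕ} (h : k ≤ l) : E.posterior l 0 ≤ E.posterior k 0 := by
  refine E.posterior_mono ?_
  have h1 := E.sigL_pos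
  have h2 := E.sigH_pos
  simp only [likelihoodRatio_eq, mul_zero, Real.exp_zero, mul_one]
  exact pow_le_pow_of_le_one (by positivity) E.ratio_lt_one.le h

/-- At zero sample variance the ratio is `(sigL / sigH) ^ k`, strictly decreasing in `k`. This
produces the strict gap between `bestVar` and `secondVar`. -/
lemma posterior_zero_strictAnti {k l : ℕ} (h : k < l) : E.posterior l 0 < E.posterior k 0 := by
  refine E.posterior_strictMono ?_
  have h1 := E.sigL_pos
  have h2 := E.sigH_pos
  simp only [likelihoodRatio_eq, mul_zero, Real.exp_zero, mul_one]
  exact pow_lt_pow_right_of_lt_one₀ (by positivity) E.ratio_lt_one h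

lemma posterior_mem (k : ℕ) (s : ℝ) : E.posterior k s ∈ Set.Icc (0 : ℝ) 1 := by
  have h1 := E.mu_pos
  have h2 : 0 < 1 - E.mu := by linarith [E.mu_lt_one]
  have h3 := E.likelihoodRatio_pos k s
  unfold posterior
  exact ⟨by positivity, div_le_one_of_le₀ (by linarith) (by positivity)⟩

/-- The exponential multiplies the numerator exactly, while it can only increase the denominator. -/
lemma posterior_le_mul_exp (k : ℕ) {s : ℝ} (hs : 0 ≤ s) :
    E.posterior k s ≤ E.posterior k 0 * Real.exp (E.ratioSlope k * s) := by
  have h1 := E.mu_pos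
  have h2 : 0 < 1 - E.mu := by linarith [E.mu_lt_one]
  have h3 := E.likelihoodRatio_pos k 0
  have h4 : 1 ≤ Real.exp (E.ratioSlope k * s) :=
    Real.one_le_exp (mul_nonneg (E.ratioSlope_nonneg k) hs)
  have e : E.likelihoodRatio k s = E.likelihoodRatio k 0 * Real.exp (E.ratioSlope k * s) := by
    simp [likelihoodRatio_eq]
  unfold posterior
  rw [e, div_mul_eq_mul_div, ← mul_assoc]
  refine div_le_div_of_nonneg_left (by positivity) (by positivity) ?_
  have : E.likelihoodRatio k 0 ≤ E.likelihoodRatio k 0 * Real.exp (E.ratioSlope k * s) :=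
    le_mul_of_one_le_right h3.le h4
  rw [mul_assoc]
  have := mul_le_mul_of_nonneg_left this h2.le
  linarith

lemma meanVar_posterior_le (k : ℕ) {s : ℝ} (hs : 0 ≤ s) :
    E.meanVar (E.posterior k s) ≤
      E.meanVar (E.posterior k 0) * Real.exp (E.ratioSlope k * s) := by
  have h1 := E.posterior_le_mul_exp k hs
  have h4 : 1 ≤ Real.exp (E.ratioSlope k * s) :=
    Real.one_le_exp (mul_nonneg (E.ratioSlope_nonneg k) hs)
  have h5 := E.sigL_sq_lt
  have h6 : 0 < E.sigL ^ 2 := pow_pos E.sigL_pos 2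
  have e : ∀ p, E.meanVar p = E.sigL ^ 2 + p * (E.sigH ^ 2 - E.sigL ^ 2) := by
    intro p; unfold meanVar; ring
  rw [e, e]
  nlinarith [mul_le_mul_of_nonneg_right h1 (sub_pos.2 h5).le]

/-- A lower bound on the density of the low-variance samples near their mean. -/
def densityBound : ℝ := (√(2 * Real.pi * E.sigL ^ 2))⁻¹ * Real.exp (-1 / 2)

lemma densityBound_pos : 0 < E.densityBound := by
  have := E.sigL_pos
  unfold densityBound; positivity

lemma le_gaussianReal_Icc (θ : ℝ) {η : ℝ} (hη : η ≤ E.sigL) :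
    2 * η * E.densityBound ≤
      (gaussianReal θ (Real.toNNReal (E.sigL ^ 2))).real (Set.Icc (θ - η) (θ + η)) := by
  have hσ := E.sigL_pos
  have hv : Real.toNNReal (E.sigL ^ 2) ≠ 0 := by simp [hσ.ne']
  have : ENNReal.ofReal (2 * η * E.densityBound) ≤
      gaussianReal θ (Real.toNNReal (E.sigL ^ 2)) (Set.Icc (θ - η) (θ + η)) := by
    rw [gaussianReal_apply θ hv]
    calc ENNReal.ofReal (2 * η * E.densityBound)
        = ∫⁻ _ in Set.Icc (θ - η) (θ + η), ENNReal.ofReal E.densityBound := by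
          rw [setLIntegral_const, Real.volume_Icc, ← ENNReal.ofReal_mul E.densityBound_pos.le]
          congr 1; ring
      _ ≤ _ := by
          refine setLIntegral_mono' measurableSet_Icc fun x hx => ENNReal.ofReal_le_ofReal ?_
          rw [gaussianPDFReal_def]
          simp only [densityBound, Real.coe_toNNReal _ (sq_nonneg E.sigL)]
          refine mul_le_mul_of_nonneg_left (Real.exp_le_exp.2 ?_) (by positivity)
          have hx2 : (x - θ) ^ 2 ≤ E.sigL ^ 2 :=
            sq_le_sq' (by linarith [hx.1]) (by linarith [hx.2])
          rw [div_le_div_iff₀ (by norm_num) (by positivity)]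
          linarith
  exact (ENNReal.ofReal_le_iff_le_toReal (measure_ne_top _ _)).1 this

/-- Only the low-variance component of the mixture is kept. The bound does not involve `θ`, which
makes the final threshold independent of `θ`. -/
lemma le_freeSampleLaw (θ : ℝ) (m : ℕ) {η : ℝ} (h0 : 0 ≤ η) (hη : η ≤ E.sigL) :
    E.mu * (2 * η * E.densityBound) ^ m ≤
      (E.freeSampleLaw θ m).real (Set.univ.pi fun _ => Set.Icc (θ - η) (θ + η)) := by
  have h1 : E.mu * (normalSamples θ E.sigL m).real
      (Set.univ.pi fun _ => Set.Icc (θ - η) (θ + η)) ≤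
      (E.freeSampleLaw θ m).real (Set.univ.pi fun _ => Set.Icc (θ - η) (θ + η)) := by
    have hfin : ∀ a σ, (ENNReal.ofReal a • normalSamples θ σ m)
        (Set.univ.pi fun _ => Set.Icc (θ - η) (θ + η)) ≠ ⊤ := fun a σ =>
      ENNReal.mul_ne_top ENNReal.ofReal_ne_top (measure_ne_top _ _)
    rw [freeSampleLaw, measureReal_add_apply (hfin _ _) (hfin _ _)]
    simp only [measureReal_ennreal_smul_apply, ENNReal.toReal_ofReal E.mu_pos.le]
    exact le_add_of_nonneg_right (by positivity)
  refine le_trans (mul_le_mul_of_nonneg_left ?_ E.mu_pos.le) h1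
  rw [normalSamples, Measure.real, Measure.pi_pi, Finset.prod_const, Finset.card_univ,
    Fintype.card_fin, ENNReal.toReal_pow]
  have := E.densityBound_pos
  exact pow_le_pow_left₀ (by positivity) (E.le_gaussianReal_Icc θ hη) m

end Market

/-- Deviations from the sample mean have a smaller sum of squares than deviations from `θ`, and `(k
+ 1) / k ≤ 2`. -/
lemma sampleVar_le {m : ℕ} (hm : 2 ≤ m) {θ η : ℝ} {x : Fin m → ℝ}
    (hx : x ∈ Set.univ.pi fun _ => Set.Icc (θ - η) (θ + η)) : sampleVar x ≤ 2 * η ^ 2 := by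
  obtain ⟨k, rfl⟩ : ∃ k, m = k + 1 := ⟨m - 1, by omega⟩
  have hk : 1 ≤ k := by omega
  have hk1 : (1 : ℝ) ≤ k := by exact_mod_cast hk
  have h := sum_sub_sq_eq hk x θ
  have h1 : ∑ j, (x j - θ) ^ 2 ≤ ((k : ℝ) + 1) * η ^ 2 := by
    calc ∑ j, (x j - θ) ^ 2 ≤ ∑ _j : Fin (k + 1), η ^ 2 := Finset.sum_le_sum fun j _ => by
          have := hx j trivial
          exact sq_le_sq' (by linarith [this.1]) (by linarith [this.2])
      _ = _ := by simp
  have h2 : 0 ≤ ((k : ℝ) + 1) * ((∑ j, x j) / ((k : ℝ) + 1) - θ) ^ 2 := by positivity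
  have h3 : (k : ℝ) * sampleVar x ≤ k * (2 * η ^ 2) := by nlinarith [sq_nonneg η]
  exact le_of_mul_le_mul_left h3 (by linarith)

namespace Market

variable (E : Market) {K : ℕ}

/-! ### Ex-ante payoffs under single-sourcing -/

/-- Seller `i`'s ex-post payoff at truthful reports in the single-sourcing mechanism. -/
def sourcePayoff (p c : Fin K → ℝ) (s : Ranking K) (i : Fin K) : ℝ :=
  ∫ z in (c i)..E.cmax, (E.sourcePurchase p (Function.update c i z) s i : ℝ)

/-- An upper bound on ex-post payoffs. -/
def payoffBound : ℝ := E.purchaseBound * (E.cmax - E.cmin)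

/-- The joint law of free samples, costs and tie-breaking. -/
def fullLaw (θ : ℝ) (m : Fin K → ℕ) :
    Measure ((∀ j, Fin (m j) → ℝ) × ((Fin K → ℝ) × Ranking K)) :=
  (Measure.pi fun j => E.freeSampleLaw θ (m j)).prod (E.costSeedLaw K (rankingLaw K))

instance (θ : ℝ) (m : Fin K → ℕ) : IsProbabilityMeasure (E.fullLaw θ m) := by
  unfold fullLaw; infer_instance

/-- The beliefs formed from the free samples. -/
def beliefs (θ : ℝ) {m : Fin K → ℕ} (x : ∀ j, Fin (m j) → ℝ) (j : Fin K) : ℝ :=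
  E.belief θ (x j)

lemma exAntePayoff_eq (θ : ℝ) (m : Fin K → ℕ) (i : Fin K) :
    E.exAntePayoff (rankingLaw K) (E.singleSourcing (K := K)) θ m i =
      ∫ y, E.sourcePayoff (E.beliefs θ y.1) y.2.1 y.2.2 i ∂E.fullLaw θ m := by
  unfold exAntePayoff
  simp only [sellerUtility_truthful]
  rfl

lemma measurable_beliefs (θ : ℝ) (m : Fin K → ℕ) :
    Measurable fun x : (∀ j, Fin (m j) → ℝ) => E.beliefs θ x :=
  measurable_pi_lambda _ fun j => (E.measurable_belief θ (m j)).comp (measurable_pi_apply j)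

lemma measurable_sourcePayoff_comp {Y : Type*} [MeasurableSpace Y] (i : Fin K)
    {p c : Y → Fin K → ℝ} {s : Y → Ranking K} (hp : Measurable p) (hc : Measurable c)
    (hs : Measurable s) : Measurable fun y => E.sourcePayoff (p y) (c y) (s y) i := by
  have hcast : Measurable fun n : ℕ => (n : ℝ) := measurable_from_top
  have hn := E.measurable_sourcePurchase_comp (Y := Y × ℝ) i (hp.comp measurable_fst)
    (measurable_update_param i (hc.comp measurable_fst) measurable_snd) (hs.comp measurable_fst)
  exact Measurable.intervalIntegral_param (a := fun y => c y i) (b := fun _ => E.cmax)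
    (g := fun y z => (E.sourcePurchase (p y) (Function.update (c y) i z) (s y) i : ℝ))
    (hcast.comp hn) (by fun_prop) measurable_const

lemma measurable_sourcePayoff (θ : ℝ) (m : Fin K → ℕ) (i : Fin K) :
    Measurable fun y : (∀ j, Fin (m j) → ℝ) × ((Fin K → ℝ) × Ranking K) =>
      E.sourcePayoff (E.beliefs θ y.1) y.2.1 y.2.2 i :=
  E.measurable_sourcePayoff_comp i ((E.measurable_beliefs θ m).comp measurable_fst)
    (measurable_fst.comp measurable_snd) (measurable_snd.comp measurable_snd)

lemma ae_fullLaw (θ : ℝ) (m : Fin K → ℕ) :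
    ∀ᵐ y ∂E.fullLaw θ m, (∀ j, y.2.1 j ∈ Set.Icc E.cmin E.cmax) ∧
      ∀ j, E.beliefs θ y.1 j = E.posterior (m j - 1) (sampleVar (y.1 j)) := by
  refine Filter.Eventually.and ?_ ?_
  · exact (Measure.quasiMeasurePreserving_snd
      (μ := Measure.pi fun j => E.freeSampleLaw θ (m j))
      (ν := E.costSeedLaw K (rankingLaw K))).ae (E.ae_costSeedLaw (rankingLaw K))
  · rw [ae_all_iff]
    intro j
    exact ((measurePreserving_eval (fun j => E.freeSampleLaw θ (m j)) j).quasiMeasurePreserving.comp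
      (Measure.quasiMeasurePreserving_fst (μ := Measure.pi fun j => E.freeSampleLaw θ (m j))
        (ν := E.costSeedLaw K (rankingLaw K)))).ae (E.ae_belief θ (m j))

lemma beliefs_mem (θ : ℝ) {m : Fin K → ℕ} (x : ∀ j, Fin (m j) → ℝ) (j : Fin K) :
    E.beliefs θ x j ∈ Set.Icc (0 : ℝ) 1 := E.belief_mem θ (x j)

variable {E} {ℓ L : ℝ}

lemma payoffBound_nonneg : 0 ≤ E.payoffBound :=
  mul_nonneg E.purchaseBound_nonneg (by linarith [E.cmin_lt_cmax])

-- A seller not selected at its true cost is not selected at any higher cost either, so the whole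
-- rent integral vanishes.
open Classical in
lemma Regular.sourcePayoff_le (h : E.Regular ℓ L) {p c : Fin K → ℝ} {s : Ranking K} {i : Fin K}
    (hp : p i ∈ Set.Icc (0 : ℝ) 1) (hc : c i ∈ Set.Icc E.cmin E.cmax) :
    E.sourcePayoff p c s i ≤ if E.IsSelected p c s i then E.payoffBound else 0 := by
  split_ifs with hsel
  · exact integral_purchase_le h hp hc
  · refine le_of_eq ?_
    unfold sourcePayoff
    rw [intervalIntegral.integral_congr (g := fun _ => 0)]
    · simp
    · intro z hz
      rw [Set.uIcc_of_le hc.2] at hz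
      have h1 : (E.sourcePurchase p (Function.update c i z) s i : ℝ) ≤
          E.sourcePurchase p (Function.update c i (c i)) s i :=
        h.sourcePurchase_antitone (c := c) (s := s) hp hc ⟨hc.1.trans hz.1, hz.2⟩ hz.1
      rw [Function.update_eq_self, sourcePurchase_eq E p c, if_neg hsel, Nat.cast_zero] at h1
      exact le_antisymm h1 (Nat.cast_nonneg _)

lemma sourcePayoff_nonneg {p c : Fin K → ℝ} {s : Ranking K} {i : Fin K}
    (hc : c i ≤ E.cmax) : 0 ≤ E.sourcePayoff p c s i :=
  E.integral_purchase_nonneg p c s i hc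

lemma Regular.integrable_sourcePayoff (h : E.Regular ℓ L) (θ : ℝ) (m : Fin K → ℕ) (i : Fin K) :
    Integrable (fun y => E.sourcePayoff (E.beliefs θ y.1) y.2.1 y.2.2 i) (E.fullLaw θ m) := by
  refine Integrable.of_bound (E.measurable_sourcePayoff θ m i).aestronglyMeasurable
    E.payoffBound ?_
  filter_upwards [E.ae_fullLaw θ m] with y hy
  rw [Real.norm_of_nonneg (sourcePayoff_nonneg (hy.1 i).2)]
  exact integral_purchase_le h (E.beliefs_mem θ y.1 i) (hy.1 i)

lemma exAntePayoff_nonneg (θ : ℝ) (m : Fin K → ℕ) (i : Fin K) :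
    0 ≤ E.exAntePayoff (rankingLaw K) (E.singleSourcing (K := K)) θ m i := by
  rw [exAntePayoff_eq]
  refine integral_nonneg_of_ae ?_
  filter_upwards [E.ae_fullLaw θ m] with y hy using sourcePayoff_nonneg (hy.1 i).2

/-- Only the selected seller earns anything, so total payoffs are bounded. -/
lemma Regular.sum_exAntePayoff_le (h : E.Regular ℓ L) (θ : ℝ) (m : Fin K → ℕ) :
    ∑ i, E.exAntePayoff (rankingLaw K) (E.singleSourcing (K := K)) θ m i ≤ E.payoffBound := by
  classical
  simp only [exAntePayoff_eq]
  rw [← integral_finsetSum _ fun i _ => h.integrable_sourcePayoff θ m i]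
  have : E.payoffBound = ∫ _, E.payoffBound ∂E.fullLaw θ m := by simp
  rw [this]
  refine integral_mono_ae (integrable_finsetSum _ fun i _ => h.integrable_sourcePayoff θ m i)
    (integrable_const _) ?_
  filter_upwards [E.ae_fullLaw θ m] with y hy
  refine (Finset.sum_le_sum fun i _ =>
    h.sourcePayoff_le (s := y.2.2) (E.beliefs_mem θ y.1 i) (hy.1 i)).trans ?_
  by_cases hex : ∃ i, E.IsSelected (E.beliefs θ y.1) y.2.1 y.2.2 i
  · obtain ⟨i, hi⟩ := hex
    rw [Finset.sum_eq_single i (fun j _ hj => if_neg fun hs => hj (hs.eq hi)) (by simp), if_pos hi]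
  · rw [Finset.sum_eq_zero fun i _ => if_neg fun hi => hex ⟨i, hi⟩]
    exact payoffBound_nonneg

/-! ### Neighbourhoods of the best outcome. -/

variable (E)

/-- The lowest possible mean variance after `M` free samples. -/
def bestVar : ℝ := E.meanVar (E.posterior (E.M - 1) 0)

/-- A lower bound on the mean variance after fewer than `M` free samples. -/
def secondVar : ℝ := E.meanVar (E.posterior (E.M - 2) 0)

lemma bestVar_pos : 0 < E.bestVar := E.meanVar_pos (E.posterior_mem _ _)

lemma bestVar_lt_secondVar : E.bestVar < E.secondVar := by
  have := E.two_le_M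
  exact E.meanVar_strictMono (E.posterior_zero_strictAnti (by omega))

lemma bestVar_le {k : ℕ} (hk : k ≤ E.M - 1) {s : ℝ} (hs : 0 ≤ s) :
    E.bestVar ≤ E.meanVar (E.posterior k s) :=
  E.meanVar_strictMono.monotone ((E.posterior_zero_antitone hk).trans (E.posterior_zero_le k hs))

/-- Fewer than `M` free samples leave at most `M - 2` degrees of freedom; for `M = 2` this is the
case of no samples. -/
lemma secondVar_le {k : ℕ} (hk : k ≤ E.M - 2) {s : ℝ} (hs : 0 ≤ s) :
    E.secondVar ≤ E.meanVar (E.posterior k s) :=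
  E.meanVar_strictMono.monotone ((E.posterior_zero_antitone hk).trans (E.posterior_zero_le k hs))

/-- The largest relative increase of the virtual cost per relative increase of the cost. -/
def costSlope (_E : Market) (ℓ L : ℝ) : ℝ := 1 + L / ℓ

/-- `e` bounds the relative size of, and `b` scales, the neighbourhoods of the best outcome on
which payoffs are estimated. -/
structure IsTuned (ℓ L e b : ℝ) : Prop where
  e_pos : 0 < e
  e_le_one : e ≤ 1
  gap : E.bestVar * (1 + e) ≤ E.secondVar
  cost : E.cmin * e / (3 * E.costSlope ℓ L) ≤ E.cmax - E.cmin
  density : L * E.cmin * e ≤ 1 / 2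
  b_pos : 0 < b
  b_le : b ≤ E.sigL
  slope : 12 * E.ratioSlope (E.M - 1) * b ^ 2 ≤ 1

variable {E}

lemma Regular.costSlope_pos (h : E.Regular ℓ L) : 0 < E.costSlope ℓ L := by
  have := h.pos
  have := h.pos_L
  unfold costSlope; positivity

lemma Regular.exists_isTuned (h : E.Regular ℓ L) : ∃ e b, E.IsTuned ℓ L e b := by
  have hL := h.pos_L
  have hκ := h.costSlope_pos
  have hc := E.cmin_pos
  have hcc := sub_pos.2 E.cmin_lt_cmax
  have hv := E.bestVar_pos
  have hv' := sub_pos.2 E.bestVar_lt_secondVar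
  have hβ := E.ratioSlope_nonneg (E.M - 1)
  have hσ := E.sigL_pos
  set κ := E.costSlope ℓ L
  -- The last three arguments correspond to the fields `gap`, `cost` and `density`.
  set e := min (min 1 ((E.secondVar - E.bestVar) / E.bestVar))
    (min ((E.cmax - E.cmin) * (3 * κ) / E.cmin) (1 / (2 * (L * E.cmin)))) with he
  have e1 : e ≤ 1 := (min_le_left _ _).trans (min_le_left _ _)
  have e2 : e ≤ (E.secondVar - E.bestVar) / E.bestVar := (min_le_left _ _).trans (min_le_right _ _)
  have e3 : e ≤ (E.cmax - E.cmin) * (3 * κ) / E.cmin := (min_le_right _ _).trans (min_le_left _ _)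
  have e4 : e ≤ 1 / (2 * (L * E.cmin)) := (min_le_right _ _).trans (min_le_right _ _)
  set b := min E.sigL (1 / (1 + 12 * E.ratioSlope (E.M - 1))) with hb
  have b0 : 0 < b := lt_min hσ (by positivity)
  have b1 : b ≤ 1 / (1 + 12 * E.ratioSlope (E.M - 1)) := min_le_right _ _
  refine ⟨e, b, ⟨?_, e1, ?_, ?_, ?_, b0, min_le_left _ _, ?_⟩⟩
  · exact lt_min (lt_min one_pos (by positivity)) (lt_min (by positivity) (by positivity))
  · rw [le_div_iff₀ hv] at e2; linarith
  · rw [le_div_iff₀ hc] at e3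
    rw [div_le_iff₀ (by positivity)]; linarith
  · rw [le_div_iff₀ (by positivity)] at e4; linarith
  · rw [le_div_iff₀ (by positivity)] at b1
    have b2 : b ≤ 1 := by nlinarith
    nlinarith

section

variable {e b ε : ℝ}

/-- A seller with `M` free samples, nearly minimal sample variance and nearly minimal cost has a
nearly minimal index. -/
lemma IsTuned.costIndex_lt (ht : E.IsTuned ℓ L e b) (h : E.Regular ℓ L) (hε : 0 < ε)
    (hεe : ε ≤ e) {s c : ℝ} (hs : 0 ≤ s) (hs' : s ≤ 2 * (b * ε) ^ 2) (hc : E.cmin ≤ c)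
    (hc' : c ≤ E.cmin + E.cmin * ε / (3 * E.costSlope ℓ L)) :
    E.costIndex (E.posterior (E.M - 1) s) c < E.bestVar * E.cmin * (1 + ε) := by
  have hκ := h.costSlope_pos
  have hcm := E.cmin_pos
  have hv := E.bestVar_pos
  have hε1 : ε ≤ 1 := hεe.trans ht.e_le_one
  have hβ := E.ratioSlope_nonneg (E.M - 1)
  have hcmax : c ≤ E.cmax := by
    have : E.cmin * ε / (3 * E.costSlope ℓ L) ≤ E.cmin * e / (3 * E.costSlope ℓ L) := by gcongr
    linarith [ht.cost]
  -- The field `slope` is calibrated here: `2 (b ε)²` times the rate is at most `ε² / 6`, and `ε ≤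
  -- 1`.
  have hβs : E.ratioSlope (E.M - 1) * s ≤ ε / 6 := by
    have h1 := mul_le_mul_of_nonneg_left hs' hβ
    have h2 := mul_le_mul_of_nonneg_right ht.slope (sq_nonneg ε)
    nlinarith
  have hβs0 : 0 ≤ E.ratioSlope (E.M - 1) * s := mul_nonneg hβ hs
  have hexp : Real.exp (E.ratioSlope (E.M - 1) * s) ≤ 1 + ε / 3 := by
    have := Real.abs_exp_sub_one_le (x := E.ratioSlope (E.M - 1) * s)
      (by rw [abs_of_nonneg hβs0]; linarith)
    rw [abs_of_nonneg hβs0] at this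
    linarith [le_abs_self (Real.exp (E.ratioSlope (E.M - 1) * s) - 1)]
  have hV : E.meanVar (E.posterior (E.M - 1) s) ≤ E.bestVar * (1 + ε / 3) :=
    (E.meanVar_posterior_le _ hs).trans (mul_le_mul_of_nonneg_left hexp hv.le)
  have hψ : E.virtualCost c ≤ E.cmin * (1 + ε / 3) := by
    refine (h.virtualCost_le ⟨hc, hcmax⟩).trans ?_
    have : (1 + L / ℓ) * (c - E.cmin) ≤ E.costSlope ℓ L * (E.cmin * ε / (3 * E.costSlope ℓ L)) :=
      mul_le_mul_of_nonneg_left (by linarith) hκ.le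
    have e2 : E.costSlope ℓ L * (E.cmin * ε / (3 * E.costSlope ℓ L)) = E.cmin * (ε / 3) := by
      field_simp
    linarith
  calc E.costIndex (E.posterior (E.M - 1) s) c
      ≤ (E.bestVar * (1 + ε / 3)) * (E.cmin * (1 + ε / 3)) :=
        mul_le_mul hV hψ (E.virtualCost_pos hc).le (by positivity)
    _ = E.bestVar * E.cmin * (1 + ε / 3) ^ 2 := by ring
    -- Two factors with relative error `ε / 3` leave room for strictness, since `ε² / 9 < ε / 3`.
    _ < E.bestVar * E.cmin * (1 + ε) := by
        refine mul_lt_mul_of_pos_left ?_ (by positivity)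
        nlinarith

/-- The samples all lie within `η` of `θ`. -/
def nearSamples (θ η : ℝ) (m : ℕ) : Set (Fin m → ℝ) :=
  Set.univ.pi fun _ => Set.Icc (θ - η) (θ + η)

lemma measurableSet_nearSamples (θ η : ℝ) (m : ℕ) : MeasurableSet (nearSamples θ η m) :=
  MeasurableSet.univ_pi fun _ => measurableSet_Icc

/-- A lower bound on the probability that all free samples lie within `b ε` of `θ`. -/
lemma IsTuned.le_nearSamples (ht : E.IsTuned ℓ L e b) (hε : 0 < ε)
    (hεe : ε ≤ e) (θ : ℝ) {m : ℕ} (hm : m = E.M) :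
    E.mu * (2 * b * E.densityBound * ε) ^ E.M ≤
      (E.freeSampleLaw θ m).real (nearSamples θ (b * ε) m) := by
  have hb := ht.b_pos
  have hε1 : ε ≤ 1 := hεe.trans ht.e_le_one
  have := E.le_freeSampleLaw θ m (η := b * ε) (by positivity)
    ((mul_le_of_le_one_right hb.le hε1).trans ht.b_le)
  refine le_trans (le_of_eq ?_) this
  rw [hm]
  congr 2
  ring

end

end Market

namespace Market

variable {E : Market} {K : ℕ} {ℓ L e b : ℝ}

/-! ### Fewer than `M` free samples -/

lemma integral_one_sub_indicator {X : Type*} [MeasurableSpace X] (μ : Measure X)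
    [IsProbabilityMeasure μ] {S : Set X} (hS : MeasurableSet S) (a : ℝ) :
    ∫ x, (1 - a * S.indicator 1 x) ∂μ = 1 - a * μ.real S := by
  have hi : Integrable (S.indicator (1 : X → ℝ)) μ := (integrable_const (1 : ℝ)).indicator hS
  rw [integral_sub (integrable_const _) (hi.const_mul a), integral_const_mul,
    integral_indicator_one hS]
  simp

/-- A seller offering fewer than `M` free samples is selected only if every seller offering `M`
free samples misses the neighbourhood of the best outcome. -/
lemma IsTuned.not_isSelected (ht : E.IsTuned ℓ L e b) (h : E.Regular ℓ L) {θ : ℝ}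
    {m : Fin K → ℕ} {i j : Fin K} (hi : m i ≤ E.M - 1) (hj : m j = E.M)
    {x : ∀ j, Fin (m j) → ℝ} {c : Fin K → ℝ} {s : Ranking K}
    (hc : ∀ j, c j ∈ Set.Icc E.cmin E.cmax)
    (hx : ∀ j, E.beliefs θ x j = E.posterior (m j - 1) (sampleVar (x j)))
    (hxj : x j ∈ nearSamples θ (b * e) (m j))
    (hcj : c j ≤ E.cmin + E.cmin * e / (3 * E.costSlope ℓ L)) :
    ¬E.IsSelected (E.beliefs θ x) c s i := by
  intro hsel
  have h1 := hsel.le j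
  have hj1 : m j - 1 = E.M - 1 := by rw [hj]
  rw [hx i, hx j, hj1] at h1
  have h2 := ht.costIndex_lt h ht.e_pos le_rfl (sampleVar_nonneg (x j))
    (sampleVar_le (hj.symm ▸ E.two_le_M) hxj) (hc j).1 hcj
  have h3 : E.secondVar * E.cmin ≤ E.costIndex (E.posterior (m i - 1) (sampleVar (x i))) (c i) :=
    mul_le_mul (E.secondVar_le (by omega) (sampleVar_nonneg _))
      ((hc i).1.trans (E.le_virtualCost _)) E.cmin_pos.le (E.meanVar_pos (E.posterior_mem _ _)).le
  have h4 := mul_le_mul_of_nonneg_right ht.gap E.cmin_pos.le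
  linarith

/-- Payoffs are bounded and vanish without selection, which requires all sellers offering `M` to
miss the neighbourhood. Misses are independent, so their probabilities multiply. -/
lemma IsTuned.exAntePayoff_le (ht : E.IsTuned ℓ L e b) (h : E.Regular ℓ L) (θ : ℝ)
    {m : Fin K → ℕ} {i : Fin K} (hi : m i ≤ E.M - 1) :
    E.exAntePayoff (rankingLaw K) (E.singleSourcing (K := K)) θ m i ≤
      E.payoffBound * (1 - E.mu * (2 * b * E.densityBound * e) ^ E.M *
        (ℓ * (E.cmin * e / (3 * E.costSlope ℓ L)))) ^
          (Finset.univ.filter fun j => m j = E.M).card := by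
  classical
  have hκ := h.costSlope_pos
  have hcm := E.cmin_pos
  have he := ht.e_pos
  set z := E.cmin + E.cmin * e / (3 * E.costSlope ℓ L) with hz
  have hz1 : z ≤ E.cmax := by linarith [ht.cost]
  set S : ∀ j, Set (Fin (m j) → ℝ) := fun j => nearSamples θ (b * e) (m j) with hS
  have hSm : ∀ j, MeasurableSet (S j) := fun j => measurableSet_nearSamples _ _ _
  set u : ∀ j, (Fin (m j) → ℝ) → ℝ := fun j => (S j).indicator 1 with hu
  set v : ℝ → ℝ := (Set.Icc E.cmin z).indicator 1 with hv
  have hum : ∀ j, Measurable (u j) := fun j => measurable_one.indicator (hSm j)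
  have hvm : Measurable v := measurable_one.indicator measurableSet_Icc
  have hu01 : ∀ j x, u j x ∈ Set.Icc (0 : ℝ) 1 := fun j x => by
    simp only [hu, Set.indicator, Pi.one_apply]; split_ifs <;> simp
  have hv01 : ∀ c, v c ∈ Set.Icc (0 : ℝ) 1 := fun c => by
    simp only [hv, Set.indicator, Pi.one_apply]; split_ifs <;> simp
  -- For a seller offering `M`, `g` is the indicator of missing the neighbourhood in samples or in
  -- cost; the other sellers contribute the neutral factor one.
  set g : ∀ j, (Fin (m j) → ℝ) → ℝ → ℝ := fun j x c =>
    if m j = E.M then 1 - u j x * v c else 1 with hg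
  have hg01 : ∀ j x c, g j x c ∈ Set.Icc (0 : ℝ) 1 := fun j x c => by
    simp only [hg]
    split_ifs
    · have h1 := hu01 j x
      have h2 := hv01 c
      exact ⟨by nlinarith [h1.1, h1.2, h2.1, h2.2], by nlinarith [mul_nonneg h1.1 h2.1]⟩
    · simp
  have hprod : ∀ (x : ∀ j, Fin (m j) → ℝ) (c : Fin K → ℝ),
      ∏ j, g j (x j) (c j) ∈ Set.Icc (0 : ℝ) 1 := fun x c =>
    ⟨Finset.prod_nonneg fun j _ => (hg01 j _ _).1,
      Finset.prod_le_one (fun j _ => (hg01 j _ _).1) fun j _ => (hg01 j _ _).2⟩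
  have hgm : Measurable fun y : (∀ j, Fin (m j) → ℝ) × ((Fin K → ℝ) × Ranking K) =>
      ∏ j, g j (y.1 j) (y.2.1 j) := by
    refine Finset.measurable_prod _ fun j _ => ?_
    simp only [hg]
    split_ifs
    · exact measurable_const.sub (((hum j).comp ((measurable_pi_apply j).comp measurable_fst)).mul
        (hvm.comp ((measurable_pi_apply j).comp (measurable_fst.comp measurable_snd))))
    · exact measurable_const
  have hgi : Integrable (fun y : (∀ j, Fin (m j) → ℝ) × ((Fin K → ℝ) × Ranking K) =>
      ∏ j, g j (y.1 j) (y.2.1 j)) (E.fullLaw θ m) :=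
    Integrable.of_bound hgm.aestronglyMeasurable 1 (ae_of_all _ fun y => by
      rw [Real.norm_of_nonneg (hprod _ _).1]; exact (hprod _ _).2)
  have hle : E.exAntePayoff (rankingLaw K) (E.singleSourcing (K := K)) θ m i ≤
      ∫ y, E.payoffBound * ∏ j, g j (y.1 j) (y.2.1 j) ∂E.fullLaw θ m := by
    rw [exAntePayoff_eq]
    refine integral_mono_ae (h.integrable_sourcePayoff θ m i) (hgi.const_mul _) ?_
    filter_upwards [E.ae_fullLaw θ m] with y hy
    refine (h.sourcePayoff_le (E.beliefs_mem θ y.1 i) (hy.1 i)).trans ?_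
    split_ifs with hsel
    · rw [Finset.prod_eq_one, mul_one]
      intro j _
      simp only [hg]
      split_ifs with hmj
      · by_cases hxj : y.1 j ∈ S j
        · have : y.2.1 j ∉ Set.Icc E.cmin z := fun hcj =>
            ht.not_isSelected h hi hmj hy.1 hy.2 hxj hcj.2 hsel
          simp [hv, this]
        · simp [hu, hxj]
      · rfl
    · exact mul_nonneg payoffBound_nonneg (hprod _ _).1
  refine hle.trans ?_
  rw [integral_const_mul]
  refine mul_le_mul_of_nonneg_left ?_ payoffBound_nonneg
  -- Costs are integrated out first, given the samples; each of the two integrals factorises over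
  -- the sellers.
  have hFub : ∫ y, ∏ j, g j (y.1 j) (y.2.1 j) ∂E.fullLaw θ m =
      ∏ j, if m j = E.M then
        1 - E.costLaw.real (Set.Icc E.cmin z) * (E.freeSampleLaw θ (m j)).real (S j) else 1 := by
    rw [fullLaw, integral_prod _ hgi]
    calc _ = ∫ x : (∀ j, Fin (m j) → ℝ), ∏ j, (if m j = E.M then
          1 - E.costLaw.real (Set.Icc E.cmin z) * u j (x j) else 1)
          ∂Measure.pi (fun j => E.freeSampleLaw θ (m j)) := by
          refine integral_congr_ae (ae_of_all _ fun x => ?_)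
          simp only [costSeedLaw]
          rw [integral_fun_fst (f := fun c : Fin K → ℝ => ∏ j, g j (x j) (c j)),
            integral_fintype_prod_eq_prod (f := fun j c => g j (x j) c)]
          simp only [probReal_univ, one_smul]
          refine Finset.prod_congr rfl fun j _ => ?_
          simp only [hg]
          split_ifs
          · rw [integral_one_sub_indicator _ measurableSet_Icc, mul_comm]
          · simp
      _ = _ := by
          rw [integral_fintype_prod_eq_prod (f := fun j x => if m j = E.M then
            1 - E.costLaw.real (Set.Icc E.cmin z) * u j x else 1)]
          refine Finset.prod_congr rfl fun j _ => ?_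
          split_ifs
          · exact integral_one_sub_indicator _ (hSm j) _
          · simp
  rw [hFub, Finset.prod_ite, Finset.prod_const_one, mul_one]
  rw [← Finset.prod_const]
  refine Finset.prod_le_prod (fun j _ => ?_) (fun j hj => ?_)
  · exact sub_nonneg.2 (mul_le_one₀ measureReal_le_one measureReal_nonneg measureReal_le_one)
  · have h1 := ht.le_nearSamples he le_rfl θ (Finset.mem_filter.1 hj).2
    have h2 := h.le_costLaw_Icc le_rfl hz1
    rw [hz, add_sub_cancel_left] at h2
    have := E.densityBound_pos
    have := ht.b_pos
    have := E.mu_pos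
    have := h.pos
    rw [mul_comm]
    exact sub_le_sub_left (mul_le_mul h1 h2 (by positivity) measureReal_nonneg) 1

/-! ### The maximal number of free samples -/

/-- A seller offering `M` free samples is selected in the neighbourhood of the best outcome if
the costs of the other sellers offering `M` free samples are not too low. -/
lemma IsTuned.isSelected (ht : E.IsTuned ℓ L e b) (h : E.Regular ℓ L) {ε : ℝ} (hε : 0 < ε)
    (hεe : ε ≤ e) {θ : ℝ} {m : Fin K → ℕ} {i : Fin K} (hi : m i = E.M) (hm : ∀ j, m j ≤ E.M)
    {x : ∀ j, Fin (m j) → ℝ} {c : Fin K → ℝ} {s : Ranking K}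
    (hc : ∀ j, c j ∈ Set.Icc E.cmin E.cmax)
    (hx : ∀ j, E.beliefs θ x j = E.posterior (m j - 1) (sampleVar (x j)))
    (hxi : x i ∈ nearSamples θ (b * ε) (m i))
    (hcj : ∀ j, j ≠ i → m j = E.M → E.cmin * (1 + ε) ≤ c j) {z : ℝ} (hz0 : E.cmin ≤ z)
    (hz : z ≤ E.cmin + E.cmin * ε / (3 * E.costSlope ℓ L)) :
    E.IsSelected (E.beliefs θ x) (Function.update c i z) s i := by
  have hcm := E.cmin_pos
  have hi1 : m i - 1 = E.M - 1 := by rw [hi]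
  have h2 := ht.costIndex_lt h hε hεe (sampleVar_nonneg (x i))
    (sampleVar_le (hi.symm ▸ E.two_le_M) hxi) hz0 hz
  intro j
  by_cases hji : j = i
  · subst hji; exact Or.inr ⟨rfl, le_rfl⟩
  · left
    rw [Function.update_self, Function.update_of_ne hji, hx i, hx j, hi1]
    refine h2.trans_le ?_
    by_cases hj : m j = E.M
    · rw [mul_assoc]
      exact mul_le_mul (E.bestVar_le (by omega) (sampleVar_nonneg _))
        ((hcj j hji hj).trans (E.le_virtualCost _)) (by positivity)
        (E.meanVar_pos (E.posterior_mem _ _)).le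
    · have h3 : E.secondVar * E.cmin ≤
          E.costIndex (E.posterior (m j - 1) (sampleVar (x j))) (c j) :=
        mul_le_mul (E.secondVar_le (by have := hm j; omega) (sampleVar_nonneg _))
          ((hc j).1.trans (E.le_virtualCost _)) hcm.le (E.meanVar_pos (E.posterior_mem _ _)).le
      have h4 := mul_le_mul_of_nonneg_right ht.gap hcm.le
      have h5 : E.bestVar * E.cmin * (1 + ε) ≤ E.bestVar * E.cmin * (1 + e) :=
        mul_le_mul_of_nonneg_left (by linarith) (mul_pos E.bestVar_pos hcm).le
      linarith

variable {α : ℝ}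

/-- The seller wins at every cost in a window of length `cmin ε / (3 κ)` above `cmin`, where `κ` is
`costSlope`, and sells at least one sample there. A true cost in the lower half of the window leaves
the upper half as rent. -/
lemma IsTuned.le_sourcePayoff (ht : E.IsTuned ℓ L e b) (h : E.Regular ℓ L) (hα : 1 < α)
    (hσ : α * √(E.lam * E.virtualCost E.cmax) ≤ E.sigL) {ε : ℝ} (hε : 0 < ε)
    (hεe : ε ≤ e) {θ : ℝ} {m : Fin K → ℕ} {i : Fin K} (hi : m i = E.M) (hm : ∀ j, m j ≤ E.M)
    {x : ∀ j, Fin (m j) → ℝ} {c : Fin K → ℝ} {s : Ranking K}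
    (hc : ∀ j, c j ∈ Set.Icc E.cmin E.cmax)
    (hx : ∀ j, E.beliefs θ x j = E.posterior (m j - 1) (sampleVar (x j)))
    (hxi : x i ∈ nearSamples θ (b * ε) (m i))
    (hcj : ∀ j, j ≠ i → m j = E.M → E.cmin * (1 + ε) ≤ c j)
    (hci : c i ≤ E.cmin + E.cmin * ε / (6 * E.costSlope ℓ L)) :
    E.cmin * ε / (6 * E.costSlope ℓ L) ≤ E.sourcePayoff (E.beliefs θ x) c s i := by
  classical
  have hcm := E.cmin_pos
  have hκ := h.costSlope_pos
  set z := E.cmin + E.cmin * ε / (3 * E.costSlope ℓ L) with hz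
  have hsplit : E.cmin * ε / (3 * E.costSlope ℓ L) =
      E.cmin * ε / (6 * E.costSlope ℓ L) + E.cmin * ε / (6 * E.costSlope ℓ L) := by
    field_simp; norm_num
  have hδ : 0 < E.cmin * ε / (6 * E.costSlope ℓ L) := by positivity
  have hciz : c i ≤ z := by linarith
  have hzmax : z ≤ E.cmax := by
    have : E.cmin * ε / (3 * E.costSlope ℓ L) ≤ E.cmin * e / (3 * E.costSlope ℓ L) := by gcongr
    linarith [ht.cost]
  have hp := E.beliefs_mem θ x i
  have hanti := h.sourcePurchase_antitone (c := c) (s := s) (i := i) hp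
  have hint : ∀ {a a' : ℝ}, a ∈ Set.Icc E.cmin E.cmax → a' ∈ Set.Icc E.cmin E.cmax →
      IntervalIntegrable (fun t =>
        (E.sourcePurchase (E.beliefs θ x) (Function.update c i t) s i : ℝ)) volume a a' :=
    fun ha ha' => (hanti.mono (Set.uIcc_subset_Icc ha ha')).intervalIntegrable
  have hzm : z ∈ Set.Icc E.cmin E.cmax := ⟨(hc i).1.trans hciz, hzmax⟩
  have hmax : E.cmax ∈ Set.Icc E.cmin E.cmax := ⟨E.cmin_lt_cmax.le, le_rfl⟩
  unfold sourcePayoff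
  rw [← intervalIntegral.integral_add_adjacent_intervals (hint (hc i) hzm) (hint hzm hmax)]
  have h1 := intervalIntegral.integral_mono_on hciz (intervalIntegrable_const (c := (1 : ℝ)))
    (hint (hc i) hzm) fun t ht' => by
      have ht0 : t ∈ Set.Icc E.cmin E.cmax := ⟨(hc i).1.trans ht'.1, ht'.2.trans hzmax⟩
      rw [sourcePurchase_eq, if_pos (ht.isSelected h hε hεe hi hm hc hx hxi hcj ht0.1 ht'.2),
        Function.update_self]
      exact_mod_cast h.one_le_quantity hα hσ hp ht0
  have h2 := E.integral_purchase_nonneg (E.beliefs θ x) c s i hzmax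
  rw [intervalIntegral.integral_const, smul_eq_mul, mul_one] at h1
  linarith

/-- The payoff is restricted to an event of product form: the seller's samples are close to `θ`, its
cost is in the half-window, and the competitors offering `M` have costs outside `[cmin, cmin (1 +
ε)]`. Sellers offering fewer need no restriction. -/
lemma IsTuned.le_exAntePayoff_of_card_le (ht : E.IsTuned ℓ L e b) (h : E.Regular ℓ L) (hα : 1 < α)
    (hσ : α * √(E.lam * E.virtualCost E.cmax) ≤ E.sigL) {ε : ℝ} (hε : 0 < ε)
    (hεe : ε ≤ e) (θ : ℝ) {m : Fin K → ℕ} {i : Fin K} (hi : m i = E.M) (hm : ∀ j, m j ≤ E.M)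
    (hcard : L * E.cmin * ε * (Finset.univ.filter fun j => j ≠ i ∧ m j = E.M).card ≤ 1 / 2) :
    E.cmin * ε / (6 * E.costSlope ℓ L) * (E.mu * (2 * b * E.densityBound * ε) ^ E.M *
      (ℓ * (E.cmin * ε / (6 * E.costSlope ℓ L)) * (1 / 2))) ≤
      E.exAntePayoff (rankingLaw K) (E.singleSourcing (K := K)) θ m i := by
  classical
  have hcm := E.cmin_pos
  have hκ := h.costSlope_pos
  have hL := h.pos_L
  have hε1 : ε ≤ 1 := hεe.trans ht.e_le_one
  set δ := E.cmin * ε / (6 * E.costSlope ℓ L) with hδ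
  have hδ0 : 0 < δ := by positivity
  have hδmax : E.cmin + δ ≤ E.cmax := by
    have h1 : δ ≤ E.cmin * e / (3 * E.costSlope ℓ L) := by
      exact div_le_div₀ (mul_pos hcm ht.e_pos).le (mul_le_mul_of_nonneg_left hεe hcm.le)
        (by positivity) (by linarith)
    linarith [ht.cost]
  set A := Finset.univ.filter fun j => j ≠ i ∧ m j = E.M with hA
  set C : Fin K → Set ℝ := fun j => if j = i then Set.Icc E.cmin (E.cmin + δ)
    else if m j = E.M then (Set.Icc E.cmin (E.cmin * (1 + ε)))ᶜ else Set.univ with hC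
  have hCm : ∀ j, MeasurableSet (C j) := fun j => by
    simp only [hC]
    split_ifs
    · exact measurableSet_Icc
    · exact measurableSet_Icc.compl
    · exact MeasurableSet.univ
  set T : Set ((∀ j, Fin (m j) → ℝ) × ((Fin K → ℝ) × Ranking K)) :=
    (Function.eval i ⁻¹' nearSamples θ (b * ε) (m i)) ×ˢ (Set.univ.pi C ×ˢ Set.univ) with hT
  have hTm : MeasurableSet T :=
    (measurable_pi_apply i (measurableSet_nearSamples _ _ _)).prod
      ((MeasurableSet.univ_pi hCm).prod MeasurableSet.univ)
  have hprob : (E.fullLaw θ m).real T =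
      (E.freeSampleLaw θ (m i)).real (nearSamples θ (b * ε) (m i)) *
        ∏ j, E.costLaw.real (C j) := by
    rw [fullLaw, costSeedLaw, hT, measureReal_prod_prod, measureReal_prod_prod, probReal_univ,
      mul_one]
    congr 1
    · rw [measureReal_def, (measurePreserving_eval (fun j => E.freeSampleLaw θ (m j))
        i).measure_preimage (measurableSet_nearSamples _ _ _).nullMeasurableSet, measureReal_def]
    · rw [measureReal_def, Measure.pi_pi, ENNReal.toReal_prod]
      rfl
  have hcosts : ℓ * δ * (1 / 2) ≤ ∏ j, E.costLaw.real (C j) := by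
    rw [← Finset.mul_prod_erase _ _ (Finset.mem_univ i)]
    refine mul_le_mul ?_ ?_ (by norm_num) measureReal_nonneg
    · have := h.le_costLaw_Icc (a := E.cmin) (b := E.cmin + δ) le_rfl hδmax
      simpa [hC] using this
    · set q := 1 - L * E.cmin * ε with hq
      have hq0 : 0 ≤ q := by
        have := mul_le_mul_of_nonneg_left hεe (mul_pos hL hcm).le
        linarith [ht.density]
      have hlow : ∀ j ∈ Finset.univ.erase i, (if m j = E.M then q else 1) ≤
          E.costLaw.real (C j) := by
        intro j hj
        have hji := Finset.ne_of_mem_erase hj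
        simp only [hC, if_neg hji]
        split_ifs
        · rw [probReal_compl_eq_one_sub measurableSet_Icc]
          have := h.costLaw_Icc_le (a := E.cmin) (b := E.cmin * (1 + ε)) (by nlinarith)
          rw [hq]
          linarith
        · simp
      refine le_trans ?_ (Finset.prod_le_prod (fun j _ => ?_) hlow)
      · have hfilter : (Finset.univ.erase i).filter (fun j => m j = E.M) = A := by
          ext j; simp [hA]
        rw [Finset.prod_ite, Finset.prod_const_one, mul_one, Finset.prod_const, hfilter]
        -- Bernoulli's inequality: by `hcard`, all these competitors stay away with probability at
        -- least one half.
        have hb := one_add_mul_le_pow (a := -(L * E.cmin * ε)) (by linarith) A.card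
        rw [← sub_eq_add_neg, ← hq] at hb
        linarith
      · split_ifs
        · exact hq0
        · exact zero_le_one
  have hnear := ht.le_nearSamples hε hεe θ hi
  have hmu := E.mu_pos
  have hdb := E.densityBound_pos
  have hb := ht.b_pos
  have hℓ := h.pos
  calc δ * (E.mu * (2 * b * E.densityBound * ε) ^ E.M * (ℓ * δ * (1 / 2)))
      ≤ δ * (E.fullLaw θ m).real T := by
        rw [hprob]
        exact mul_le_mul_of_nonneg_left (mul_le_mul hnear hcosts (by positivity)
          measureReal_nonneg) hδ0.le
    _ = ∫ y, T.indicator (fun _ => δ) y ∂E.fullLaw θ m := by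
        rw [integral_indicator_const _ hTm, smul_eq_mul, mul_comm]
    _ ≤ _ := by
        rw [exAntePayoff_eq]
        refine integral_mono_ae ((integrable_const _).indicator hTm)
          (h.integrable_sourcePayoff θ m i) ?_
        filter_upwards [E.ae_fullLaw θ m] with y hy
        by_cases hyT : y ∈ T
        · rw [Set.indicator_of_mem hyT]
          refine ht.le_sourcePayoff h hα hσ hε hεe hi hm hy.1 hy.2 hyT.1 (fun j hji hj => ?_) ?_
          · have := hyT.2.1 j trivial
            simp only [hC, if_neg hji, if_pos hj, Set.mem_compl_iff, Set.mem_Icc, not_and,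
              not_le] at this
            exact (this (hy.1 j).1).le
          · have := hyT.2.1 i trivial
            simp only [hC, if_true] at this
            exact this.2
        · rw [Set.indicator_of_notMem hyT]
          exact sourcePayoff_nonneg (hy.1 i).2

/-- With `M` free samples the payoff decays at most polynomially in the number of competitors
offering as many. -/
lemma IsTuned.le_exAntePayoff (ht : E.IsTuned ℓ L e b) (h : E.Regular ℓ L) (hα : 1 < α)
    (hσ : α * √(E.lam * E.virtualCost E.cmax) ≤ E.sigL) (θ : ℝ) {m : Fin K → ℕ} {i : Fin K}
    (hi : m i = E.M) (hm : ∀ j, m j ≤ E.M) :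
    E.mu * (2 * b * E.densityBound * e) ^ E.M * (ℓ * (1 / 2)) *
      (E.cmin * e / (6 * E.costSlope ℓ L)) ^ 2 /
        ((Finset.univ.filter fun j => j ≠ i ∧ m j = E.M).card + 1 : ℝ) ^ (E.M + 2) ≤
      E.exAntePayoff (rankingLaw K) (E.singleSourcing (K := K)) θ m i := by
  have hcm := E.cmin_pos
  have hκ := h.costSlope_pos
  have hL := h.pos_L
  have he := ht.e_pos
  set a : ℝ := ((Finset.univ.filter fun j => j ≠ i ∧ m j = E.M).card : ℝ) with ha
  have ha0 : 0 ≤ a := Nat.cast_nonneg _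
  have ha1 : 0 < a + 1 := by linarith
  have hεe : e / (a + 1) ≤ e := div_le_self he.le (by linarith)
  -- The window shrinks like `1 / (a + 1)`, so that the expected number of competitors in it stays
  -- at most one half. The exponent `M + 2` counts one factor for each free sample, one for the own
  -- cost and one for the rent.
  refine le_trans (le_of_eq ?_) (ht.le_exAntePayoff_of_card_le h hα hσ (ε := e / (a + 1))
    (by positivity) hεe θ hi hm ?_)
  · have r1 : E.cmin * (e / (a + 1)) / (6 * E.costSlope ℓ L) =
        E.cmin * e / (6 * E.costSlope ℓ L) / (a + 1) := by ring
    have r2 : 2 * b * E.densityBound * (e / (a + 1)) =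
        2 * b * E.densityBound * e / (a + 1) := by ring
    rw [r1, r2, div_pow _ _ E.M, pow_add]
    field_simp
  · rw [← ha]
    have : L * E.cmin * (e / (a + 1)) * a ≤ L * E.cmin * e := by
      rw [← mul_div_assoc, div_mul_eq_mul_div, div_le_iff₀ ha1]
      nlinarith [mul_pos (mul_pos hL hcm) he]
    linarith [ht.density]

end Market

/-! ### Comparing the payoff bounds, and the equilibrium. -/

namespace Market

/-- Payoffs with fewer than `M` free samples are exponentially small in the number of sellers
offering `M`, while those with `M` free samples are only polynomially small. -/
lemma Regular.exists_payoff_bounds {E : Market} {ℓ L α : ℝ} (h : E.Regular ℓ L) (hα : 1 < α)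
    (hσ : α * √(E.lam * E.virtualCost E.cmax) ≤ E.sigL) :
    ∃ (C q : ℝ) (φ : ℕ → ℝ) (A₀ : ℕ), (∀ a, 0 < φ a) ∧ Antitone φ ∧
      (∀ a, A₀ ≤ a → C * q ^ a < φ a) ∧
      (∀ (K : ℕ) (θ : ℝ) (m : Fin K → ℕ) (i : Fin K), m i ≤ E.M - 1 →
        E.exAntePayoff (rankingLaw K) (E.singleSourcing (K := K)) θ m i ≤
          C * q ^ (Finset.univ.filter fun j => m j = E.M).card) ∧
      (∀ (K : ℕ) (θ : ℝ) (m : Fin K → ℕ) (i : Fin K), m i = E.M → (∀ j, m j ≤ E.M) →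
        φ (Finset.univ.filter fun j => j ≠ i ∧ m j = E.M).card ≤
          E.exAntePayoff (rankingLaw K) (E.singleSourcing (K := K)) θ m i) := by
  obtain ⟨e, b, ht⟩ := h.exists_isTuned
  have hcm := E.cmin_pos
  have hκ := h.costSlope_pos
  have he := ht.e_pos
  have hmu := E.mu_pos
  have hdb := E.densityBound_pos
  have hb := ht.b_pos
  have hℓ := h.pos
  set c := E.mu * (2 * b * E.densityBound * e) ^ E.M * (ℓ * (1 / 2)) *
      (E.cmin * e / (6 * E.costSlope ℓ L)) ^ 2 with hc
  have hc0 : 0 < c := by positivity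
  set r := E.mu * (2 * b * E.densityBound * e) ^ E.M *
    (ℓ * (E.cmin * e / (3 * E.costSlope ℓ L))) with hr
  have hr0 : 0 < r := by positivity
  -- `r` is a product of lower bounds on two probabilities.
  have hr1 : r ≤ 1 := by
    refine mul_le_one₀ ((ht.le_nearSamples he le_rfl 0 rfl).trans measureReal_le_one)
      (by positivity) ?_
    have := h.le_costLaw_Icc (a := E.cmin)
      (b := E.cmin + E.cmin * e / (3 * E.costSlope ℓ L)) le_rfl
      (by linarith [ht.cost])
    rw [add_sub_cancel_left] at this
    exact this.trans measureReal_le_one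
  have hlim : Filter.Tendsto (fun a : ℕ => E.payoffBound * (1 - r) ^ a * ((a : ℝ) + 1) ^ (E.M + 2))
      Filter.atTop (nhds 0) := by
    -- The case `r = 1` is separate because the index shift below divides by `1 - r`.
    rcases hr1.eq_or_lt with hr1 | hr1
    · refine tendsto_const_nhds.congr' ?_
      filter_upwards [Filter.eventually_ge_atTop 1] with a ha
      rw [hr1, sub_self, zero_pow (by omega), mul_zero, zero_mul]
    · have hq : 0 < 1 - r := by linarith
      have h1 := (tendsto_pow_const_mul_const_pow_of_abs_lt_one (E.M + 2) (r := 1 - r)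
        (by rw [abs_of_pos hq]; linarith)).comp (Filter.tendsto_add_atTop_nat 1)
      have h2 := h1.const_mul (E.payoffBound / (1 - r))
      rw [mul_zero] at h2
      refine h2.congr fun a => ?_
      simp only [Function.comp_apply]
      push_cast
      rw [pow_succ (1 - r) a]
      field_simp
  obtain ⟨A₀, hA₀⟩ := Filter.eventually_atTop.1 (hlim.eventually_lt_const hc0)
  refine ⟨E.payoffBound, 1 - r, fun a => c / ((a : ℝ) + 1) ^ (E.M + 2), A₀,
    fun a => by positivity, fun a a' haa' => ?_, fun a ha => ?_,
    fun K θ m i hi => ht.exAntePayoff_le h θ hi, fun K θ m i hi hm =>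
      ht.le_exAntePayoff h hα hσ θ hi hm⟩
  · have : (a : ℝ) ≤ a' := by exact_mod_cast haa'
    exact div_le_div_of_nonneg_left hc0.le (by positivity) (by gcongr)
  · rw [lt_div_iff₀ (by positivity)]
    exact hA₀ a ha

end Market

end

theorem theorem2 (E : Market) (ℓ L α : ℝ)
    (hψ : MonotoneOn E.virtualCost (Set.Icc E.cmin E.cmax))
    (hℓ : 0 < ℓ)
    (hf : ∀ c ∈ Set.Icc E.cmin E.cmax, ℓ ≤ E.f c ∧ E.f c ≤ L)
    (hα : 3 ≤ α)
    (hσ : α * √(E.lam * E.virtualCost E.cmax) ≤ E.sigL) :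
    ∃ Kbar : ℕ, ∀ K : ℕ, Kbar ≤ K → ∀ θ : ℝ,
      E.IsApproxSPE (rankingLaw K) (1 / (α - 1)) (E.singleSourcing (K := K)) θ
          (fun _ => E.M) ∧
        ∀ m : Fin K → ℕ,
          E.IsSellerEquilibrium (rankingLaw K) (E.singleSourcing (K := K)) θ m →
            m = fun _ => E.M := by
  classical
  have h : E.Regular ℓ L := ⟨hψ, hℓ, fun c hc => (hf c hc).1, fun c hc => (hf c hc).2⟩
  have hα1 : 1 < α := by linarith
  obtain ⟨C, q, φ, A₀, hφ, hanti, hlt, hup, hlow⟩ := h.exists_payoff_bounds hα1 hσ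
  -- `n` sellers earning at least `φ A₀` each would exceed the bound on total payoffs. With `K > A₀
  -- + n`, fewer than `A₀` sellers offering `M` leave more than `n` others.
  obtain ⟨n, hn⟩ := exists_nat_gt (E.payoffBound / φ A₀)
  refine ⟨A₀ + n + 1, fun K hK θ => ?_⟩
  have : NeZero K := ⟨by omega⟩
  have hMfree : E.M ∈ E.freeSizes := ⟨le_rfl, by have := E.two_le_M; omega⟩
  have hlt_M : ∀ k ∈ E.freeSizes, k ≠ E.M → k ≤ E.M - 1 := fun k hk hkM => by
    have := hk.1; omega
  refine ⟨⟨fun p hp => h.isApproxSolution_singleSourcing hα1 hσ hp, fun _ => hMfree,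
    fun i m' hm' => ?_⟩, fun m hm => ?_⟩
  · by_cases hmM : m' = E.M
    · subst hmM
      rw [Function.update_eq_self_iff.2 rfl]
    -- The deviator faces the `K - 1` others, who all offer `M`; both payoff bounds are evaluated at
    -- this same number.
    · have h1 := hup K θ (Function.update (fun _ => E.M) i m') i (by simpa using hlt_M m' hm' hmM)
      have h2 := hlow K θ (fun _ => E.M) i rfl fun _ => le_rfl
      have hc1 : (Finset.univ.filter fun j : Fin K =>
          Function.update (fun _ => E.M) i m' j = E.M) = Finset.univ.filter fun j => j ≠ i := by
        ext j
        by_cases hj : j = i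
        · subst hj; simp [hmM]
        · simp [hj]
      have hc2 : (Finset.univ.filter fun j : Fin K => j ≠ i).card = K - 1 := by
        simp [Finset.filter_ne']
      rw [hc1, hc2] at h1
      simp only [and_true] at h2
      rw [hc2] at h2
      exact h1.trans ((hlt (K - 1) (by omega)).le.trans h2)
  · by_contra hne
    set A := Finset.univ.filter fun j : Fin K => m j = E.M with hA
    -- A seller outside `A` who switches to `M` has exactly the members of `A` as competitors
    -- offering `M`; in equilibrium it earns at least what this switch guarantees.
    have hdev : ∀ i, m i ≠ E.M → φ A.card ≤
        E.exAntePayoff (rankingLaw K) (E.singleSourcing (K := K)) θ m i := by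
      intro i hi
      refine le_trans ?_ (hm.2 i E.M hMfree)
      have h2 := hlow K θ (Function.update m i E.M) i (by simp) fun j => by
        by_cases hj : j = i
        · subst hj; simp
        · simpa [Function.update_of_ne hj] using (hm.1 j).1
      have hc : (Finset.univ.filter fun j : Fin K =>
          j ≠ i ∧ Function.update m i E.M j = E.M) = A := by
        ext j
        by_cases hj : j = i
        · subst hj; simp [hA, hi]
        · simp [hA, hj]
      rwa [hc] at h2
    obtain ⟨i, hi⟩ : ∃ i, m i ≠ E.M := by
      by_contra hcon
      push Not at hcon
      exact hne (funext hcon)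
    -- With many sellers offering `M`, the exponential bound contradicts `hdev` for a single seller.
    -- With few, `hdev` summed over all sellers outside `A` exceeds the bound on total payoffs.
    rcases le_or_gt A₀ A.card with hcase | hcase
    · have h1 := hup K θ m i (hlt_M _ (hm.1 i) hi)
      exact absurd ((hdev i hi).trans h1) (hlt A.card hcase).not_ge
    · have hsum := h.sum_exAntePayoff_le θ m
      have hcompl : n < (Aᶜ).card := by
        rw [Finset.card_compl, Fintype.card_fin]; omega
      have h1 : (Aᶜ).card * φ A.card ≤
          ∑ i, E.exAntePayoff (rankingLaw K) (E.singleSourcing (K := K)) θ m i := by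
        calc (Aᶜ).card * φ A.card = ∑ _i ∈ Aᶜ, φ A.card := by
              rw [Finset.sum_const, nsmul_eq_mul]
          _ ≤ ∑ i ∈ Aᶜ, E.exAntePayoff (rankingLaw K) (E.singleSourcing (K := K)) θ m i :=
              Finset.sum_le_sum fun i hi => hdev i (by simpa [hA] using hi)
          _ ≤ _ := Finset.sum_le_univ_sum_of_nonneg fun i => Market.exAntePayoff_nonneg θ m i
      have h2 : φ A₀ ≤ φ A.card := hanti hcase.le
      rw [div_lt_iff₀ (hφ A₀)] at hn
      have h3 : (n : ℝ) * φ A₀ ≤ (Aᶜ).card * φ A.card :=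
        mul_le_mul (by exact_mod_cast hcompl.le) h2 (hφ A₀).le (by positivity)
      linarith
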